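/- Let $d\ge 1$, $\varepsilon>0$, let $F:\mathbb R^d\to\mathbb R$ be $C^1$ with $\nabla F$ locally Lipschitz and $F(x)\to+\infty$ as $\|x\|\to\infty$, and let $S:\mathbb R^d\to\mathbb R_+^d$ be locally Lipschitz, where $\mathbb R_+=[0,\infty)$. Let $h,r,p,q:(0,\infty)\to\mathbb R_+$ be continuous functions such that: $h$ is $C^1$ with $\dot h\le 0$ and $h_\infty=\lim_{t\to\infty}h(t)>0$; $r$ and $q$ are non-increasing, with $r_\infty=\lim_{t\to\infty}r(t)>0$ and $q_\infty=\lim_{t\to\infty}q(t)>0$; $p(t)$ converges to a finite limit $p_\infty$ as $t\to\infty$; $r(t)\ge q(t)/4$ for all $t>0$, and $r_\infty>q_\infty/4$. Put $\mathcal Z_+=\mathbb R_+^d\times\mathbb R^d\times\mathbb R^d$. For $t_0\ge 0$ and $z_0\in\mathcal Z_+$, a global solution of (ODE-1) started from $z_0$ at time $t_0$ is a continuous function $z=(v,m,x):[t_0,\infty)\to\mathcal Z_+$ with $z(t_0)=z_0$ such that, for all $t\ge t_0$ with $t>0$ (the derivative being the right derivative at $t=t_0$), $$\dot v(t)=p(t)S(x(t))-q(t)v(t),\qquad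 \dot m(t)=h(t)\nabla F(x(t))-r(t)m(t),\qquad \dot x(t)=-\frac{m(t)}{\sqrt{v(t)+\varepsilon}},$$ where the quotient and the square root are taken componentwise. Let $$\Upsilon=\Big\{\big(p_\infty S(x_\star)/q_\infty,\,0,\,x_\star\big)\,:\,x_\star\in\mathbb R^d,\ \nabla F(x_\star)=0\Big\}.$$ Then, for every $t_0>0$ and $z_0\in\mathcal Z_+$, there is a unique global solution $z$ of (ODE-1) started from $z_0$ at time $t_0$; the set $z([t_0,\infty))$ is bounded; and $z(t)$ converges to the (nonempty) set $\Upsilon$, i.e. $\mathrm{dist}(z(t),\Upsilon)\to 0$ as $t\to\infty$. The same conclusions hold with $t_0=0$ for every $z_0=(v_0,m_0,x_0)\in\mathcal Z_+$ for which one of the following holds. Either $h,r,p,q$ extend to $C^1$ functions on $[0,\infty)$; or all of the following hold: (i) $S(x)_i\ge(\partial_iF(x))^2$ for all $x\in\mathbb R^d$ and all $i$; (ii) the functions $h/p$, $h/(q-2r)$, $t\mapsto t\,h(t)$, $t\mapsto t\,r(t)$, $t\mapsto t\,p(t)$, $t\mapsto t\,q(t)$ are (well defined and) bounded near zero; (iii)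 there is $t_1>0$ with $2r(t)-q(t)>0$ for all $t\in(0,t_1)$; (iv) there is $\delta>0$ such that $h/r$ and $p/q$ extend to $C^1$ functions on $[0,\delta)$; (v) $m_0=\nabla F(x_0)\lim_{t\downarrow0}h(t)/r(t)$ and $v_0=S(x_0)\lim_{t\downarrow0}p(t)/q(t)$. -/

import Mathlib

open Set Filter Topology

namespace AdamODE

/-- The Euclidean space `ℝ^d`. -/
abbrev E (d : ℕ) : Type := EuclideanSpace ℝ (Fin d)

/-- The state space `ℝ^d × ℝ^d × ℝ^d`, with states `z = (v, m, x)`. Its product norm is equivalent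
to the Euclidean one, so boundedness, derivatives and convergence to a set are the usual ones. -/
abbrev Z (d : ℕ) : Type := E d × E d × E d

/-- The states `(v, m, x)` with `v ≥ 0` componentwise. -/
def ZPlus (d : ℕ) : Set (Z d) := {z | ∀ i, 0 ≤ z.1 i}

/-- The vector field
`g((v, m, x), t) = (p(t) S(x) - q(t) v, h(t) ∇F(x) - r(t) m, - m / √(v + ε))`,
where quotient and root are taken componentwise. -/
noncomputable def field {d : ℕ} (F : E d → ℝ) (S : E d → E d) (h r p q : ℝ → ℝ) (ε : ℝ)
    (z : Z d) (t : ℝ) : Z d :=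
  (p t • S z.2.2 - q t • z.1,
   h t • gradient F z.2.2 - r t • z.2.1,
   WithLp.toLp 2 fun i => -(z.2.1 i / √(z.1 i + ε)))

/-- `z` restricted to `[t₀, ∞)` is a solution of `z' = g(z, t)` with `z(t₀) = z₀` and values in
`ZPlus`: it is continuous on `[t₀, ∞)` and satisfies the equation at every `t ≥ t₀` with `t > 0`
(the coefficients live on `(0, ∞)` only); at `t = t₀ > 0` the derivative is the right one. -/
structure IsSolution {d : ℕ} (F : E d → ℝ) (S : E d → E d) (h r p q : ℝ → ℝ) (ε : ℝ)
    (t₀ : ℝ) (z₀ : Z d) (z : ℝ → Z d) : Prop where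
  init : z t₀ = z₀
  cont : ContinuousOn z (Ici t₀)
  mem : ∀ t ∈ Ici t₀, z t ∈ ZPlus d
  eqn : ∀ t ∈ Ici t₀, 0 < t →
    HasDerivWithinAt z (field F S h r p q ε (z t) t) (Ici t₀) t

/-- The limit set `Υ = {(p∞ S(x) / q∞, 0, x) : ∇F(x) = 0}`. -/
noncomputable def limitSet {d : ℕ} (F : E d → ℝ) (S : E d → E d) (pInf qInf : ℝ) : Set (Z d) :=
  {z | ∃ x : E d, gradient F x = 0 ∧ z = ((pInf / qInf) • S x, 0, x)}

/-- `dist(z(t), A) → 0` as `t → ∞`. Nonemptiness of `A` is required because `Metric.infDist` to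
the empty set is `0` by convention. -/
def ConvergesToSet {d : ℕ} (z : ℝ → Z d) (A : Set (Z d)) : Prop :=
  A.Nonempty ∧ Tendsto (fun t => Metric.infDist (z t) A) atTop (𝓝 0)

/-- Assumptions on the coefficients `h, r, p, q : (0, ∞) → [0, ∞)`, of which only the values on
`(0, ∞)` matter, with their limits at infinity. -/
structure CoeffAssumption (h r p q : ℝ → ℝ) (hInf rInf pInf qInf : ℝ) : Prop where
  h_nonneg : ∀ t, 0 < t → 0 ≤ h t
  r_nonneg : ∀ t, 0 < t → 0 ≤ r t
  p_nonneg : ∀ t, 0 < t → 0 ≤ p t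
  q_nonneg : ∀ t, 0 < t → 0 ≤ q t
  r_cont : ContinuousOn r (Ioi 0)
  p_cont : ContinuousOn p (Ioi 0)
  q_cont : ContinuousOn q (Ioi 0)
  h_C1 : ContDiffOn ℝ 1 h (Ioi 0)
  h_deriv : ∀ t, 0 < t → deriv h t ≤ 0
  h_lim : Tendsto h atTop (𝓝 hInf)
  hInf_pos : 0 < hInf
  r_anti : AntitoneOn r (Ioi 0)
  q_anti : AntitoneOn q (Ioi 0)
  r_lim : Tendsto r atTop (𝓝 rInf)
  rInf_pos : 0 < rInf
  q_lim : Tendsto q atTop (𝓝 qInf)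
  qInf_pos : 0 < qInf
  p_lim : Tendsto p atTop (𝓝 pInf)
  r_ge : ∀ t, 0 < t → q t / 4 ≤ r t
  rInf_gt : qInf / 4 < rInf

/-- `f`, given on `(0, ∞)`, coincides on `s \ {0}` with a function that is `C¹` on `s`
(used for `s = [0, ∞)` and `s = [0, δ)`, with one-sided derivatives at `0`). -/
def ExtendsC1 (f : ℝ → ℝ) (s : Set ℝ) : Prop :=
  ∃ f' : ℝ → ℝ, ContDiffOn ℝ 1 f' s ∧ ∀ t ∈ s, 0 < t → f' t = f t

/-- `f` is bounded on some interval `(0, δ)`. -/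
def BoundedNearZero (f : ℝ → ℝ) : Prop :=
  ∃ C : ℝ, ∀ᶠ t in 𝓝[>] (0 : ℝ), |f t| ≤ C

/-- The second alternative for starting at time `0`: coefficients that may blow up at `0`. -/
structure SingularAtZero {d : ℕ} (F : E d → ℝ) (S : E d → E d) (h r p q : ℝ → ℝ)
    (z₀ : Z d) : Prop where
  S_ge : ∀ x i, (gradient F x i) ^ 2 ≤ S x i
  /-- implicit in the boundedness of `h / p`, as `h > 0` -/
  p_pos : ∀ᶠ t in 𝓝[>] (0 : ℝ), 0 < p t
  bdd_h_div_p : BoundedNearZero fun t => h t / p t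
  bdd_h_div : BoundedNearZero fun t => h t / (q t - 2 * r t)
  bdd_h : BoundedNearZero fun t => t * h t
  bdd_r : BoundedNearZero fun t => t * r t
  bdd_p : BoundedNearZero fun t => t * p t
  bdd_q : BoundedNearZero fun t => t * q t
  two_r_gt : ∃ t₁ > 0, ∀ t, 0 < t → t < t₁ → 0 < 2 * r t - q t
  ratio_C1 : ∃ δ > 0, ExtendsC1 (fun t => h t / r t) (Ico 0 δ) ∧
    ExtendsC1 (fun t => p t / q t) (Ico 0 δ)
  m_init : ∃ a : ℝ, Tendsto (fun t => h t / r t) (𝓝[>] 0) (𝓝 a) ∧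
    z₀.2.1 = a • gradient F z₀.2.2
  v_init : ∃ b : ℝ, Tendsto (fun t => p t / q t) (𝓝[>] 0) (𝓝 b) ∧ z₀.1 = b • S z₀.2.2

/-- The additional assumption that allows the starting time `0`. -/
def ZeroTimeAssumption {d : ℕ} (F : E d → ℝ) (S : E d → E d) (h r p q : ℝ → ℝ)
    (z₀ : Z d) : Prop :=
  (ExtendsC1 h (Ici 0) ∧ ExtendsC1 r (Ici 0) ∧ ExtendsC1 p (Ici 0) ∧ ExtendsC1 q (Ici 0)) ∨
    SingularAtZero F S h r p q z₀

/-- There is a unique global solution on `[t₀, ∞)` starting at `z₀`; it is bounded and converges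
to the limit set. -/
def UniqueBoundedConvergent {d : ℕ} (F : E d → ℝ) (S : E d → E d) (h r p q : ℝ → ℝ)
    (ε pInf qInf t₀ : ℝ) (z₀ : Z d) : Prop :=
  ∃ z : ℝ → Z d, IsSolution F S h r p q ε t₀ z₀ z ∧
    (∀ y : ℝ → Z d, IsSolution F S h r p q ε t₀ z₀ y → EqOn y z (Ici t₀)) ∧
    Bornology.IsBounded (z '' Ici t₀) ∧
    ConvergesToSet z (limitSet F S pInf qInf)

end AdamODE

/-! Everything rests on a Lyapunov function and on the relaxation form of the first two equations.

The energy `h (F(x) - min F) + ½ ∑ m_i² / √(v_i + ε)` is dissipated. The terms in `m · ∇F` cancel,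
`h' ≤ 0` and `p S ≥ 0` only help, and the damping of `v` costs at most `q/4`, so its derivative is
at most `-(r - q/4) ∑ m_i² / √(v_i + ε)` (`energy_hasDerivAt`). Since `h ≥ hInf > 0` and `F` is
coercive, `x` stays bounded. Next, `v' = q ((p/q) S(x) - v)` and `m' = r ((h/r) ∇F(x) - m)` are
relaxations towards moving targets, and such solutions never leave a ball containing the initial
value and the targets (`relaxation_norm_le`). The resulting bound (`exists_apriori_bound`) makes
Picard-Lindelöf for a truncated field global, and Grönwall gives uniqueness.

For convergence, `r - q/4` is eventually bounded away from `0`, so a Barbalat-type argument gives `m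
→ 0`. Hence `x' → 0`, and `x` is nearly constant on long windows. A relaxation equation tracks so
slow a target, whence `m - (hInf/rInf) ∇F(x) → 0` and `v - (pInf/qInf) S(x) → 0`. With `m → 0` this
forces `∇F(x) → 0`, and compactness of the orbit turns these limits into convergence to the limit
set.

At time zero the rates may blow up, but relaxation estimates involve only the ratios `h/r` and
`p/q`, never the size of `r` and `q`. They give stability on `[s, b]` uniformly in `s > 0`
(`stableAtZero`). Combined with a uniform modulus of continuity at the initial point, this makes the
solutions started from `z₀` at time `s` Cauchy as `s → 0`; their limit is the solution from time
zero, and the positive-time theory takes over from there. -/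

namespace AdamODE

/-! ### Differential inequalities -/

/-- A continuous function that starts below `0` and does not increase where it is positive
stays below `0`. -/
theorem nonpos_of_deriv_nonpos_of_pos {f f' : ℝ → ℝ} {a b : ℝ} (hf : ContinuousOn f (Icc a b))
    (hd : ∀ t ∈ Ioo a b, HasDerivAt f (f' t) t) (h0 : f a ≤ 0)
    (hneg : ∀ t ∈ Ioo a b, 0 < f t → f' t ≤ 0) : ∀ t ∈ Icc a b, f t ≤ 0 := by
  intro t ht
  by_contra! hpos
  have hfc : ContinuousOn f (Icc a t) := hf.mono (Icc_subset_Icc_right ht.2)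
  have hS : IsCompact (Icc a t ∩ f ⁻¹' Iic 0) :=
    isCompact_Icc.of_isClosed_subset (hfc.preimage_isClosed_of_isClosed isClosed_Icc isClosed_Iic)
      inter_subset_left
  have hu := hS.sSup_mem ⟨a, ⟨le_rfl, ht.1⟩, h0⟩
  -- `u` is the last time up to `t` at which `f ≤ 0`; on `(u, t)` the function is positive, hence
  -- nonincreasing.
  set u := sSup (Icc a t ∩ f ⁻¹' Iic 0)
  have hu0 : f u ≤ 0 := hu.2
  have hut : u < t := lt_of_le_of_ne hu.1.2 (by rintro h; rw [h] at hu0; linarith)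
  have hpos' : ∀ s ∈ Ioo u t, 0 < f s := by
    intro s hs
    by_contra! hs0
    exact absurd (le_csSup hS.bddAbove ⟨⟨hu.1.1.trans hs.1.le, hs.2.le⟩, hs0⟩) (not_le.2 hs.1)
  have hsub : ∀ s ∈ Ioo u t, s ∈ Ioo a b := fun s hs =>
    ⟨hu.1.1.trans_lt hs.1, hs.2.trans_le ht.2⟩
  have hanti : AntitoneOn f (Icc u t) := by
    refine antitoneOn_of_deriv_nonpos (convex_Icc u t)
      (hfc.mono (Icc_subset_Icc_left hu.1.1)) ?_ ?_
    · intro s hs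
      rw [interior_Icc] at hs
      exact (hd s (hsub s hs)).differentiableAt.differentiableWithinAt
    · intro s hs
      rw [interior_Icc] at hs
      rw [(hd s (hsub s hs)).deriv]
      exact hneg s (hsub s hs) (hpos' s hs)
  have := hanti ⟨le_rfl, hut.le⟩ ⟨hut.le, le_rfl⟩ hut.le
  linarith

/-- A continuous function that cannot reach the level `R` without first having exceeded it stays
below it. -/
theorem le_of_forall_Ico_le_imp_le {f : ℝ → ℝ} {a b R R' : ℝ} (hf : ContinuousOn f (Icc a b))
    (hR : R' < R) (h : ∀ t ∈ Icc a b, (∀ u ∈ Ico a t, f u ≤ R) → f t ≤ R') :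
    ∀ t ∈ Icc a b, f t ≤ R' := by
  have hS : IsCompact (Icc a b ∩ f ⁻¹' Ici R) :=
    isCompact_Icc.of_isClosed_subset (hf.preimage_isClosed_of_isClosed isClosed_Icc isClosed_Ici)
      inter_subset_left
  rcases (Icc a b ∩ f ⁻¹' Ici R).eq_empty_or_nonempty with he | hne
  · intro t ht
    refine h t ht fun u hu => ?_
    by_contra! hu'
    have : u ∈ Icc a b ∩ f ⁻¹' Ici R := ⟨⟨hu.1, hu.2.le.trans ht.2⟩, hu'.le⟩
    rw [he] at this
    exact this
  · have hτ := hS.sInf_mem hne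
    -- `τ` is the first time at which `f` reaches the level `R`; the implication applied there gives
    -- `f τ ≤ R' < R`, a contradiction.
    set τ := sInf (Icc a b ∩ f ⁻¹' Ici R)
    have h1 : R ≤ f τ := hτ.2
    have h2 := h τ hτ.1 fun u hu => by
      by_contra! hu'
      exact absurd (csInf_le hS.bddBelow ⟨⟨hu.1, hu.2.le.trans hτ.1.2⟩, hu'.le⟩) (not_le.2 hu.2)
    linarith

/-! ### Relaxation equations. -/

section Relaxation

variable {V : Type*} [NormedAddCommGroup V] [InnerProductSpace ℝ V]

/-- Solutions of the relaxation equation `y' = ρ (w - y)` approach exponentially fast any ball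
that contains `w`. -/
theorem relaxation_norm_sq_le {y w : ℝ → V} {ρ : ℝ → ℝ} {a b δ D κ : ℝ} {c : V}
    (hy : ContinuousOn y (Icc a b))
    (hd : ∀ t ∈ Ioo a b, HasDerivAt y (ρ t • (w t - y t)) t)
    (hD : 0 ≤ D) (hκ : 0 ≤ κ) (hρ : ∀ t ∈ Ioo a b, κ ≤ ρ t)
    (hw : ∀ t ∈ Ioo a b, ‖w t - c‖ ≤ δ) (h0 : ‖y a - c‖ ^ 2 ≤ δ ^ 2 + D) :
    ∀ t ∈ Icc a b, ‖y t - c‖ ^ 2 ≤ δ ^ 2 + D * Real.exp (-κ * (t - a)) := by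
  have key := nonpos_of_deriv_nonpos_of_pos
    (f := fun t => ‖y t - c‖ ^ 2 - (δ ^ 2 + D * Real.exp (-κ * (t - a))))
    (f' := fun t => 2 * inner ℝ (y t - c) (ρ t • (w t - y t)) -
      D * (Real.exp (-κ * (t - a)) * (-κ * 1))) (a := a) (b := b) (by fun_prop) ?_ ?_ ?_
  · intro t ht
    have := key t ht
    linarith
  · intro t ht
    have h1 := ((hd t ht).sub_const c).norm_sq
    have h2 : HasDerivAt (fun t => D * Real.exp (-κ * (t - a)))
        (D * (Real.exp (-κ * (t - a)) * (-κ * 1))) t :=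
      ((((hasDerivAt_id t).sub_const a).const_mul (-κ)).exp).const_mul D
    exact h1.sub (h2.const_add (δ ^ 2))
  · simpa using h0
  · intro t ht hpos
    have hin : inner ℝ (y t - c) (w t - y t) =
        inner ℝ (y t - c) (w t - c) - ‖y t - c‖ ^ 2 := by
      rw [← real_inner_self_eq_norm_sq, ← inner_sub_right]
      congr 1
      abel
    have hcs := real_inner_le_norm (y t - c) (w t - c)
    have hwt := hw t ht
    have hρt := hρ t ht
    set N := ‖y t - c‖
    set e := D * Real.exp (-κ * (t - a)) with he
    have he0 : 0 ≤ e := by positivity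
    have hN : 0 ≤ N := norm_nonneg _
    -- Cauchy-Schwarz and `2 N δ ≤ N² + δ²`.
    have h3 : 2 * (inner ℝ (y t - c) (w t - c) - N ^ 2) ≤ δ ^ 2 - N ^ 2 := by
      have : N * ‖w t - c‖ ≤ N * δ := by gcongr
      nlinarith [sq_nonneg (N - δ)]
    have h4 : δ ^ 2 - N ^ 2 ≤ -e := by linarith
    rw [inner_smul_right, hin]
    have h5 : ρ t * (2 * (inner ℝ (y t - c) (w t - c) - N ^ 2)) ≤ ρ t * (δ ^ 2 - N ^ 2) :=
      mul_le_mul_of_nonneg_left h3 (hκ.trans hρt)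
    -- Where the comparison fails, `δ² - N²` is nonpositive, so lowering the rate from `ρ t` to `κ`
    -- weakens the bound.
    have h6 : ρ t * (δ ^ 2 - N ^ 2) ≤ κ * (δ ^ 2 - N ^ 2) :=
      mul_le_mul_of_nonpos_right hρt (by linarith)
    have h7 : κ * (δ ^ 2 - N ^ 2) ≤ κ * (-e) := mul_le_mul_of_nonneg_left h4 hκ
    have h8 : D * (Real.exp (-κ * (t - a)) * (-κ * 1)) = -(κ * e) := by rw [he]; ring
    rw [h8]
    linarith

/-- Solutions of the relaxation equation `y' = ρ (w - y)` stay in any ball that contains `w`. -/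
theorem relaxation_norm_le {y w : ℝ → V} {ρ : ℝ → ℝ} {a b R : ℝ} {c : V}
    (hy : ContinuousOn y (Icc a b))
    (hd : ∀ t ∈ Ioo a b, HasDerivAt y (ρ t • (w t - y t)) t)
    (hρ : ∀ t ∈ Ioo a b, 0 ≤ ρ t)
    (hw : ∀ t ∈ Ioo a b, ‖w t - c‖ ≤ R) (h0 : ‖y a - c‖ ≤ R) :
    ∀ t ∈ Icc a b, ‖y t - c‖ ≤ R := by
  intro t ht
  have hR : 0 ≤ R := (norm_nonneg _).trans h0
  have := relaxation_norm_sq_le (D := 0) hy hd le_rfl le_rfl hρ hw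
    (by rw [add_zero]; gcongr) t ht
  rw [zero_mul, add_zero] at this
  exact le_of_sq_le_sq this hR

/-- `w` varies slowly at infinity: its oscillation over windows of a given length tends to `0`. -/
def SlowlyVarying {V : Type*} [NormedAddCommGroup V] (w : ℝ → V) : Prop :=
  ∀ L > 0, ∀ δ > 0, ∀ᶠ t in atTop, ∀ u ∈ Icc t (t + L), ‖w u - w t‖ ≤ δ

/-- Solutions of the relaxation equation `y' = ρ (w - y)` track slowly varying targets `w`. -/
theorem tendsto_sub_of_slowlyVarying {y w : ℝ → V} {ρ : ℝ → ℝ} {T κ R : ℝ}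
    (hd : ∀ t > T, HasDerivAt y (ρ t • (w t - y t)) t) (hκ : 0 < κ) (hρ : ∀ t > T, κ ≤ ρ t)
    (hyR : ∀ t > T, ‖y t‖ ≤ R) (hwR : ∀ t > T, ‖w t‖ ≤ R) (hw : SlowlyVarying w) :
    Tendsto (fun t => y t - w t) atTop (𝓝 0) := by
  rw [Metric.tendsto_atTop]
  intro η hη
  set δ := η / 4 with hδ
  have hδ0 : 0 < δ := by positivity
  have hexp : Tendsto (fun L : ℝ => (2 * R) ^ 2 * Real.exp (-κ * L)) atTop (𝓝 0) := by
    have h1 : Tendsto (fun L : ℝ => -κ * L) atTop atBot :=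
      tendsto_id.const_mul_atTop_of_neg (by linarith)
    simpa using (Real.tendsto_exp_atBot.comp h1).const_mul ((2 * R) ^ 2)
  -- A window long enough for the initial gap, at most `2R`, to be forgotten up to `δ`. At its end
  -- `y` is within `2δ` of the frozen target `w t`, which has moved by at most `δ`: in all `3δ < η`.
  obtain ⟨L, hL, hL0⟩ := ((hexp.eventually (gt_mem_nhds (show 0 < δ ^ 2 by positivity))).and
    (eventually_gt_atTop 0)).exists
  obtain ⟨T', hT'⟩ := (hw L hL0 δ hδ0).exists_forall_of_atTop
  refine ⟨max T' (T + 1) + L, fun s hs => ?_⟩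
  obtain ⟨t, rfl⟩ : ∃ t, s = t + L := ⟨s - L, by ring⟩
  have ht : max T' (T + 1) ≤ t := by linarith
  have htT : T < t := by linarith [le_max_right T' (T + 1)]
  have hslow := hT' t ((le_max_left _ _).trans ht)
  have h0 : ‖y t - w t‖ ^ 2 ≤ δ ^ 2 + (2 * R) ^ 2 := by
    have : ‖y t - w t‖ ≤ 2 * R := by linarith [norm_sub_le (y t) (w t), hyR t htT, hwR t htT]
    nlinarith [norm_nonneg (y t - w t), sq_nonneg δ]
  have key := relaxation_norm_sq_le (a := t) (b := t + L) (c := w t) (δ := δ)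
    (fun u hu => (hd u (htT.trans_le hu.1)).continuousAt.continuousWithinAt)
    (fun u hu => hd u (htT.trans hu.1)) (sq_nonneg (2 * R)) hκ.le
    (fun u hu => hρ u (htT.trans hu.1)) (fun u hu => hslow u ⟨hu.1.le, hu.2.le⟩) h0
    (t + L) ⟨by linarith, le_rfl⟩
  rw [add_sub_cancel_left] at key
  have h1 : ‖y (t + L) - w t‖ ≤ 2 * δ :=
    le_of_sq_le_sq (by nlinarith) (by positivity)
  have h2 := hslow (t + L) ⟨by linarith, le_rfl⟩
  rw [dist_zero_right]
  calc ‖y (t + L) - w (t + L)‖ = ‖(y (t + L) - w t) - (w (t + L) - w t)‖ := by congr 1; abel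
    _ ≤ ‖y (t + L) - w t‖ + ‖w (t + L) - w t‖ := norm_sub_le _ _
    _ < η := by linarith

end Relaxation

/-! ### Decay of a dissipated quantity. -/

/-- If a function `e` that is bounded below dissipates at least at the rate `c * g`, with `g`
Lipschitz and nonnegative, then `g` tends to `0`. -/
theorem tendsto_zero_of_dissipation {e e' g : ℝ → ℝ} {T c m K : ℝ} (hc : 0 < c)
    (hd : ∀ t > T, HasDerivAt e (e' t) t) (hdiss : ∀ t > T, e' t ≤ -(c * g t))
    (hm : ∀ t > T, m ≤ e t) (hg : ∀ t > T, 0 ≤ g t)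
    (hK : ∀ t > T, ∀ u ≥ t, |g u - g t| ≤ K * (u - t)) : Tendsto g atTop (𝓝 0) := by
  have hdrop : ∀ t > T, ∀ u ≥ t, ∀ k, (∀ s ∈ Ioo t u, e' s ≤ -k) → k * (u - t) ≤ e t - e u := by
    intro t ht u hu k hk
    have := (convex_Icc t u).image_sub_le_mul_sub_of_deriv_le (f := e) (C := -k)
      (fun s hs => (hd s (ht.trans_le hs.1)).continuousAt.continuousWithinAt)
      (fun s hs => by
        rw [interior_Icc] at hs
        exact (hd s (ht.trans hs.1)).differentiableAt.differentiableWithinAt)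
      (fun s hs => by
        rw [interior_Icc] at hs
        rw [(hd s (ht.trans hs.1)).deriv]
        exact hk s hs) t ⟨le_rfl, hu⟩ u ⟨hu, le_rfl⟩ hu
    linarith
  have hanti : ∀ t > T, ∀ u ≥ t, e u ≤ e t := by
    intro t ht u hu
    have := hdrop t ht u hu 0 fun s hs => by
      have h1 := hdiss s (ht.trans hs.1)
      have h2 := mul_nonneg hc.le (hg s (ht.trans hs.1))
      linarith
    linarith
  have hlim : ∀ δ > 0, ∃ t₁ > T, ∀ t ≥ t₁, ∀ u ≥ t, e t - e u ≤ δ := by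
    intro δ hδ
    have hbdd : BddBelow (e '' Ioi T) := ⟨m, by rintro _ ⟨t, ht, rfl⟩; exact hm t ht⟩
    obtain ⟨_, ⟨t₁, ht₁, rfl⟩, hlt⟩ := exists_lt_of_csInf_lt
      ((nonempty_Ioi (a := T)).image e) (lt_add_of_pos_right (sInf (e '' Ioi T)) hδ)
    refine ⟨t₁, ht₁, fun t ht u hu => ?_⟩
    have h1 := hanti t₁ ht₁ t ht
    have h2 := csInf_le hbdd ⟨u, (show T < t₁ from ht₁).trans_le (le_trans ht hu), rfl⟩
    linarith
  rw [Metric.tendsto_atTop]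
  intro η hη
  -- On a window of this length `g` cannot fall from `η` below `η/2`, so `e` would drop by at least
  -- `c (η/2) L`. Past `t₁` only half of that drop is still available.
  set L := η / (2 * (|K| + 1)) with hL
  have hL0 : 0 < L := by positivity
  obtain ⟨t₁, ht₁, h₁⟩ := hlim (c * (η / 2) * L / 2) (by positivity)
  refine ⟨t₁, fun t ht => ?_⟩
  have htT : T < t := lt_of_lt_of_le ht₁ ht
  rw [dist_zero_right, Real.norm_of_nonneg (hg t htT)]
  by_contra! hge
  have hlow : ∀ s ∈ Ioo t (t + L), e' s ≤ -(c * (η / 2)) := by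
    intro s hs
    have h1 := hdiss s (htT.trans hs.1)
    have h2 := hK t htT s hs.1.le
    have h3 : K * (s - t) ≤ η / 2 := by
      calc K * (s - t) ≤ (|K| + 1) * L := by
            apply mul_le_mul (by linarith [le_abs_self K]) (by linarith [hs.2])
              (by linarith [hs.1]) (by positivity)
        _ = η / 2 := by rw [hL]; field_simp
    have h4 : η / 2 ≤ g s := by linarith [neg_le_of_abs_le h2]
    have := mul_le_mul_of_nonneg_left h4 hc.le
    linarith
  have h5 := hdrop t htT (t + L) (by linarith) _ hlow
  have h6 := h₁ t ht (t + L) (by linarith)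
  rw [add_sub_cancel_left] at h5
  have : 0 < c * (η / 2) * L := by positivity
  linarith

end AdamODE

namespace AdamODE

/-! ### Coefficients -/

section Coeff

variable {h r p q : ℝ → ℝ} {hInf rInf pInf qInf : ℝ}

theorem le_of_antitoneOn_tendsto {f : ℝ → ℝ} {l : ℝ} (hf : AntitoneOn f (Ioi 0))
    (hl : Tendsto f atTop (𝓝 l)) {t : ℝ} (ht : 0 < t) : l ≤ f t :=
  le_of_tendsto hl <| (eventually_ge_atTop t).mono fun _ hu => hf ht (ht.trans_le hu) hu

theorem CoeffAssumption.h_anti (hc : CoeffAssumption h r p q hInf rInf pInf qInf) :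
    AntitoneOn h (Ioi 0) := by
  refine antitoneOn_of_deriv_nonpos (convex_Ioi 0) hc.h_C1.continuousOn ?_ ?_
  · rw [interior_Ioi]
    exact hc.h_C1.differentiableOn one_ne_zero
  · rw [interior_Ioi]
    exact hc.h_deriv

theorem CoeffAssumption.hInf_le (hc : CoeffAssumption h r p q hInf rInf pInf qInf) {t : ℝ}
    (ht : 0 < t) : hInf ≤ h t :=
  le_of_antitoneOn_tendsto hc.h_anti hc.h_lim ht

theorem CoeffAssumption.rInf_le (hc : CoeffAssumption h r p q hInf rInf pInf qInf) {t : ℝ}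
    (ht : 0 < t) : rInf ≤ r t :=
  le_of_antitoneOn_tendsto hc.r_anti hc.r_lim ht

theorem CoeffAssumption.qInf_le (hc : CoeffAssumption h r p q hInf rInf pInf qInf) {t : ℝ}
    (ht : 0 < t) : qInf ≤ q t :=
  le_of_antitoneOn_tendsto hc.q_anti hc.q_lim ht

theorem CoeffAssumption.r_pos (hc : CoeffAssumption h r p q hInf rInf pInf qInf) {t : ℝ}
    (ht : 0 < t) : 0 < r t :=
  hc.rInf_pos.trans_le (hc.rInf_le ht)

theorem CoeffAssumption.q_pos (hc : CoeffAssumption h r p q hInf rInf pInf qInf) {t : ℝ}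
    (ht : 0 < t) : 0 < q t :=
  hc.qInf_pos.trans_le (hc.qInf_le ht)

theorem CoeffAssumption.h_cont (hc : CoeffAssumption h r p q hInf rInf pInf qInf) :
    ContinuousOn h (Ioi 0) :=
  hc.h_C1.continuousOn

theorem CoeffAssumption.h_hasDerivAt (hc : CoeffAssumption h r p q hInf rInf pInf qInf) {t : ℝ}
    (ht : 0 < t) : HasDerivAt h (deriv h t) t :=
  ((hc.h_C1.differentiableOn one_ne_zero).differentiableAt (Ioi_mem_nhds ht)).hasDerivAt

theorem CoeffAssumption.p_bound (hc : CoeffAssumption h r p q hInf rInf pInf qInf) {a : ℝ}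
    (ha : 0 < a) : ∃ P, ∀ t ≥ a, p t ≤ P := by
  obtain ⟨b, hb⟩ := (hc.p_lim.eventually (gt_mem_nhds (lt_add_one pInf))).exists_forall_of_atTop
  obtain ⟨C, hC⟩ := (isCompact_Icc (a := a) (b := b)).bddAbove_image
    (hc.p_cont.mono fun t ht => ha.trans_le ht.1)
  refine ⟨max C (pInf + 1), fun t ht => ?_⟩
  rcases le_total t b with h1 | h1
  · exact le_max_of_le_left (hC ⟨t, ⟨ht, h1⟩, rfl⟩)
  · exact le_max_of_le_right (hb t h1).le

end Coeff

/-! ### The velocity `-m / √(v + ε)` -/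

variable {d : ℕ}

theorem norm_le_norm_of_abs_le {x y : E d} (hxy : ∀ i, |x i| ≤ |y i|) : ‖x‖ ≤ ‖y‖ := by
  rw [EuclideanSpace.norm_eq, EuclideanSpace.norm_eq]
  refine Real.sqrt_le_sqrt (Finset.sum_le_sum fun i _ => ?_)
  simpa using sq_le_sq.2 (hxy i)

/-- The triangle inequality for the vectors of absolute values; the constants do not pick up the
dimension. -/
theorem norm_le_of_abs_le_mul_add {x y w : E d} {α β : ℝ} (hα : 0 ≤ α) (hβ : 0 ≤ β)
    (hxy : ∀ i, |x i| ≤ α * |y i| + β * |w i|) : ‖x‖ ≤ α * ‖y‖ + β * ‖w‖ := by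
  let ay : E d := WithLp.toLp 2 fun i => |y i|
  let aw : E d := WithLp.toLp 2 fun i => |w i|
  have hy : ‖ay‖ ≤ ‖y‖ := norm_le_norm_of_abs_le fun i => by simp [ay]
  have hw : ‖aw‖ ≤ ‖w‖ := norm_le_norm_of_abs_le fun i => by simp [aw]
  calc ‖x‖ ≤ ‖α • ay + β • aw‖ :=
        norm_le_norm_of_abs_le fun i => (hxy i).trans (by simpa [ay, aw] using le_abs_self _)
    _ ≤ ‖α • ay‖ + ‖β • aw‖ := norm_add_le _ _
    _ = α * ‖ay‖ + β * ‖aw‖ := by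
        rw [norm_smul, norm_smul, Real.norm_of_nonneg hα, Real.norm_of_nonneg hβ]
    _ ≤ α * ‖y‖ + β * ‖w‖ := by gcongr

theorem abs_coord_le (x : E d) (i : Fin d) : |x i| ≤ ‖x‖ := by
  simpa using PiLp.norm_apply_le x i

theorem hasDerivAt_coord {y : ℝ → E d} {y' : E d} {t : ℝ} (hy : HasDerivAt y y' t) (i : Fin d) :
    HasDerivAt (fun t => y t i) (y' i) t :=
  (EuclideanSpace.proj i : E d →L[ℝ] ℝ).hasFDerivAt.comp_hasDerivAt t hy

/-- The `x`-component `-m / √(v + ε)` of the vector field. -/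
noncomputable def velocity (ε : ℝ) (v m : E d) : E d :=
  WithLp.toLp 2 fun i => -(m i / √(v i + ε))

theorem norm_velocity_le {ε : ℝ} (hε : 0 < ε) {v : E d} (hv : ∀ i, 0 ≤ v i) (m : E d) :
    ‖velocity ε v m‖ ≤ ‖m‖ / √ε := by
  have h1 := norm_le_of_abs_le_mul_add (x := velocity ε v m) (y := m) (w := 0)
    (α := (√ε)⁻¹) (β := 0) (by positivity) le_rfl fun i => by
      have : √ε ≤ √(v i + ε) := Real.sqrt_le_sqrt (by linarith [hv i])
      have h0 : 0 < √ε := Real.sqrt_pos.2 hε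
      simp only [velocity, abs_neg, abs_div, abs_of_nonneg (Real.sqrt_nonneg _), zero_mul,
        add_zero]
      rw [div_eq_inv_mul]
      gcongr
  rw [div_eq_inv_mul]
  simpa using h1

/-- Changing `m` first and the denominator afterwards leaves only `n` in the constant, so just one
of the two numerators has to be bounded. -/
theorem abs_div_sqrt_sub_div_sqrt_le {ε a b m n : ℝ} (hε : 0 < ε) (ha : 0 ≤ a) (hb : 0 ≤ b) :
    |m / √(a + ε) - n / √(b + ε)| ≤ (√ε)⁻¹ * |m - n| + |n| / (ε * √ε) * |a - b| := by
  have h0 : 0 < √ε := Real.sqrt_pos.2 hε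
  have hsa : √ε ≤ √(a + ε) := Real.sqrt_le_sqrt (by linarith)
  have hsb : √ε ≤ √(b + ε) := Real.sqrt_le_sqrt (by linarith)
  have hse : √ε * √ε = ε := Real.mul_self_sqrt hε.le
  have ea : √(a + ε) * √(a + ε) = a + ε := Real.mul_self_sqrt (by linarith)
  have eb : √(b + ε) * √(b + ε) = b + ε := Real.mul_self_sqrt (by linarith)
  set A := √(a + ε)
  set B := √(b + ε)
  have hA : 0 < A := h0.trans_le hsa
  have hB : 0 < B := h0.trans_le hsb
  have hdecomp : m / A - n / B = A⁻¹ * (m - n) + n * ((b - a) / (A * B * (A + B))) := by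
    have : b - a = B * B - A * A := by linarith
    rw [this]
    field_simp
    ring
  have hden : ε * √ε ≤ A * B * (A + B) := by
    have : ε ≤ A * B := hse ▸ mul_le_mul hsa hsb h0.le hA.le
    exact mul_le_mul this (by linarith) h0.le (by positivity)
  rw [hdecomp]
  refine (abs_add_le _ _).trans (add_le_add ?_ ?_)
  · rw [abs_mul, abs_of_pos (inv_pos.2 hA)]
    gcongr
  · rw [abs_mul, abs_div, abs_of_pos (show 0 < A * B * (A + B) by positivity), abs_sub_comm b a]
    calc |n| * (|a - b| / (A * B * (A + B))) ≤ |n| * (|a - b| / (ε * √ε)) := by gcongr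
      _ = |n| / (ε * √ε) * |a - b| := by ring

theorem norm_velocity_sub_le {ε R : ℝ} (hε : 0 < ε) {v v' m m' : E d} (hv : ∀ i, 0 ≤ v i)
    (hv' : ∀ i, 0 ≤ v' i) (hm : ‖m'‖ ≤ R) :
    ‖velocity ε v m - velocity ε v' m'‖ ≤ (√ε)⁻¹ * ‖m - m'‖ + R / (ε * √ε) * ‖v - v'‖ := by
  have hR : 0 ≤ R := (norm_nonneg _).trans hm
  refine norm_le_of_abs_le_mul_add (by positivity) (by positivity) fun i => ?_
  have h1 := abs_div_sqrt_sub_div_sqrt_le (m := m i) (n := m' i) hε (hv i) (hv' i)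
  have h2 : |m' i| / (ε * √ε) ≤ R / (ε * √ε) := by
    gcongr
    exact (abs_coord_le m' i).trans hm
  have h3 : |(velocity ε v m - velocity ε v' m') i| =
      |m i / √(v i + ε) - m' i / √(v' i + ε)| := by
    simp only [velocity, PiLp.sub_apply]
    rw [← abs_neg]
    congr 1
    ring
  rw [h3, PiLp.sub_apply, PiLp.sub_apply]
  exact h1.trans (by gcongr)

/-! ### Solutions on compact intervals -/

/-- The standing assumptions on `F`, `S` and `ε`. -/
structure Setting (F : E d → ℝ) (S : E d → E d) (ε : ℝ) : Prop where
  ε_pos : 0 < ε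
  F_C1 : ContDiff ℝ 1 F
  grad_lip : LocallyLipschitz (gradient F)
  coercive : Tendsto F (Bornology.cobounded (E d)) atTop
  S_nonneg : ∀ x i, 0 ≤ S x i
  S_lip : LocallyLipschitz S

/-- `z` solves the equation on `[a, b]`, with values in `ZPlus`. -/
structure SolOn (F : E d → ℝ) (S : E d → E d) (h r p q : ℝ → ℝ) (ε a b : ℝ) (z : ℝ → Z d) :
    Prop where
  cont : ContinuousOn z (Icc a b)
  mem : ∀ t ∈ Icc a b, z t ∈ ZPlus d
  deriv : ∀ t ∈ Ioo a b, HasDerivAt z (field F S h r p q ε (z t) t) t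

section Solutions

variable {F : E d → ℝ} {S : E d → E d} {h r p q : ℝ → ℝ} {ε hInf rInf pInf qInf a b : ℝ}
  {z : ℝ → Z d}

theorem SolOn.mono (hz : SolOn F S h r p q ε a b z) {a' b' : ℝ} (ha : a ≤ a') (hb : b' ≤ b) :
    SolOn F S h r p q ε a' b' z :=
  ⟨hz.cont.mono (Icc_subset_Icc ha hb), fun t ht => hz.mem t (Icc_subset_Icc ha hb ht),
    fun t ht => hz.deriv t (Ioo_subset_Ioo ha hb ht)⟩

theorem IsSolution.solOn {z₀ : Z d} (hz : IsSolution F S h r p q ε a z₀ z) (ha : 0 ≤ a) {a' : ℝ}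
    (haa' : a ≤ a') (b : ℝ) : SolOn F S h r p q ε a' b z where
  cont := hz.cont.mono fun _ ht => haa'.trans ht.1
  mem t ht := hz.mem t (haa'.trans ht.1)
  deriv t ht := (hz.eqn t (haa'.trans ht.1.le) (ha.trans_lt (haa'.trans_lt ht.1))).hasDerivAt
    (Ici_mem_nhds (haa'.trans_lt ht.1))

/-- The relaxation form, with rate `q` and target `(p/q) S(x)`. Bounds drawn from it see the ratio
`p/q` but not the size of `q`, which may blow up at `0`; the next lemma does the same for `m`. -/
theorem hasDerivAt_v {t : ℝ} (hq : q t ≠ 0)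
    (hd : HasDerivAt z (field F S h r p q ε (z t) t) t) :
    HasDerivAt (fun t => (z t).1) (q t • ((p t / q t) • S (z t).2.2 - (z t).1)) t := by
  have := hd.fst
  rwa [smul_sub, smul_smul, mul_div_cancel₀ _ hq]

theorem hasDerivAt_m {t : ℝ} (hr : r t ≠ 0)
    (hd : HasDerivAt z (field F S h r p q ε (z t) t) t) :
    HasDerivAt (fun t => (z t).2.1)
      (r t • ((h t / r t) • gradient F (z t).2.2 - (z t).2.1)) t := by
  have := hd.snd.fst
  rwa [smul_sub, smul_smul, mul_div_cancel₀ _ hr]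

theorem hasDerivAt_x {t : ℝ} (hd : HasDerivAt z (field F S h r p q ε (z t) t) t) :
    HasDerivAt (fun t => (z t).2.2) (velocity ε (z t).1 (z t).2.1) t :=
  hd.snd.snd

/-! ### The Lyapunov function and the a priori bound. -/

/-- `m_i² / √(v_i + ε)`, summed over `i`. -/
noncomputable def kinetic (ε : ℝ) (z : Z d) : ℝ :=
  ∑ i, (z.2.1 i) ^ 2 / √(z.1 i + ε)

/-- The Lyapunov function `h(t) (F(x) - c) + ½ ∑ m_i² / √(v_i + ε)`. -/
noncomputable def energy (F : E d → ℝ) (h : ℝ → ℝ) (ε c : ℝ) (z : ℝ → Z d) (t : ℝ) : ℝ :=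
  h t * (F (z t).2.2 - c) + kinetic ε (z t) / 2

theorem kinetic_nonneg (ε : ℝ) (z : Z d) : 0 ≤ kinetic ε z :=
  Finset.sum_nonneg fun _ _ => by positivity

/-- One coordinate of the dissipation estimate, with `s = √(v + ε)`. The terms in `m g` cancel, and
what is left beyond the right side is a nonpositive multiple of `p S + q (s² - v)`. The quarter of
`q` comes from the factor `½` in the energy and the `½` from differentiating the root. -/
theorem energy_coord_ineq {s v m g S h r p q : ℝ} (hs : 0 < s) (hv : v ≤ s ^ 2)
    (hp : 0 ≤ p) (hq : 0 ≤ q) (hS : 0 ≤ S) :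
    h * (-(m / s) * g) + (2 * m * (h * g - r * m) * s - m ^ 2 * ((p * S - q * v) / (2 * s)))
      / s ^ 2 / 2 ≤ -((r - q / 4) * (m ^ 2 / s)) := by
  have : h * (-(m / s) * g) + (2 * m * (h * g - r * m) * s - m ^ 2 * ((p * S - q * v) / (2 * s)))
      / s ^ 2 / 2 = -((r - q / 4) * (m ^ 2 / s))
        - m ^ 2 / (4 * s ^ 3) * (p * S + q * (s ^ 2 - v)) := by
    field_simp
    ring
  rw [this]
  have h1 : 0 ≤ p * S := mul_nonneg hp hS
  have h2 : 0 ≤ q * (s ^ 2 - v) := mul_nonneg hq (by linarith)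
  have h3 : 0 ≤ m ^ 2 / (4 * s ^ 3) * (p * S + q * (s ^ 2 - v)) := by positivity
  linarith

theorem energy_hasDerivAt (D : Setting F S ε) (hc : CoeffAssumption h r p q hInf rInf pInf qInf)
    {c t : ℝ} (hcF : ∀ x, c ≤ F x) (ht : 0 < t) (hmem : z t ∈ ZPlus d)
    (hd : HasDerivAt z (field F S h r p q ε (z t) t) t) :
    ∃ e', HasDerivAt (energy F h ε c z) e' t ∧
      e' ≤ -((r t - q t / 4) * kinetic ε (z t)) := by
  have hs : ∀ i, 0 < √((z t).1 i + ε) := fun i => Real.sqrt_pos.2 (by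
    have := hmem i; linarith [D.ε_pos])
  have hv : ∀ i, HasDerivAt (fun t => (z t).1 i) (p t * S (z t).2.2 i - q t * (z t).1 i) t :=
    fun i => by simpa [field] using hasDerivAt_coord hd.fst i
  have hm : ∀ i, HasDerivAt (fun t => (z t).2.1 i)
      (h t * gradient F (z t).2.2 i - r t * (z t).2.1 i) t :=
    fun i => by simpa [field] using hasDerivAt_coord hd.snd.fst i
  have hFx : HasDerivAt (fun t => F (z t).2.2)
      (inner ℝ (gradient F (z t).2.2) (velocity ε (z t).1 (z t).2.1)) t := by
    have hg := (D.F_C1.differentiable one_ne_zero (z t).2.2).hasGradientAt.hasFDerivAt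
    exact hg.comp_hasDerivAt t (hasDerivAt_x hd)
  have hki : ∀ i, HasDerivAt (fun t => ((z t).2.1 i) ^ 2 / √((z t).1 i + ε))
      ((2 * (z t).2.1 i * (h t * gradient F (z t).2.2 i - r t * (z t).2.1 i)
        * √((z t).1 i + ε) - ((z t).2.1 i) ^ 2 *
        ((p t * S (z t).2.2 i - q t * (z t).1 i) / (2 * √((z t).1 i + ε))))
        / √((z t).1 i + ε) ^ 2) t := by
    intro i
    have h1 := (hm i).fun_pow 2
    have h2 := ((hv i).add_const ε).sqrt (by have := hmem i; have := D.ε_pos; positivity)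
    have h3 := h1.fun_div h2 (hs i).ne'
    simpa using h3
  have hk := HasDerivAt.fun_sum (u := Finset.univ) fun i _ => hki i
  have hE := ((hc.h_hasDerivAt ht).mul (hFx.sub_const c)).add (hk.div_const 2)
  refine ⟨_, hE, ?_⟩
  have hin : inner ℝ (gradient F (z t).2.2) (velocity ε (z t).1 (z t).2.1) =
      ∑ i, -((z t).2.1 i / √((z t).1 i + ε)) * gradient F (z t).2.2 i := by
    rw [PiLp.inner_apply]
    simp [velocity]
  have h0 : deriv h t * (F (z t).2.2 - c) ≤ 0 :=
    mul_nonpos_of_nonpos_of_nonneg (hc.h_deriv t ht) (by linarith [hcF (z t).2.2])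
  rw [hin, kinetic, Finset.mul_sum, Finset.mul_sum, ← Finset.sum_neg_distrib, Finset.sum_div,
    add_assoc, ← Finset.sum_add_distrib]
  refine (add_le_of_nonpos_left h0).trans (Finset.sum_le_sum fun i _ => ?_)
  refine energy_coord_ineq (hs i) ?_ (hc.p_nonneg t ht) (hc.q_nonneg t ht) (D.S_nonneg _ i)
  rw [Real.sq_sqrt (by have := hmem i; have := D.ε_pos; positivity)]
  linarith [D.ε_pos]

theorem energy_continuousOn (D : Setting F S ε) {s : Set ℝ} (hh : ContinuousOn h s)
    (hz : ContinuousOn z s) (hmem : ∀ t ∈ s, z t ∈ ZPlus d) (c : ℝ) :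
    ContinuousOn (energy F h ε c z) s := by
  have hx : ContinuousOn (fun t => F (z t).2.2) s :=
    D.F_C1.continuous.comp_continuousOn hz.snd.snd
  have hk : ContinuousOn (fun t => kinetic ε (z t)) s := by
    refine continuousOn_finsetSum _ fun i _ => ContinuousOn.div ?_ ?_ ?_
    · exact ((EuclideanSpace.proj i).continuous.comp_continuousOn hz.snd.fst).pow 2
    · exact (((EuclideanSpace.proj i).continuous.comp_continuousOn hz.fst).add
        continuousOn_const).sqrt
    · intro t ht
      have := hmem t ht i
      exact (Real.sqrt_pos.2 (by linarith [D.ε_pos])).ne'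
  exact (hh.mul (hx.sub continuousOn_const)).add (hk.div_const 2)

theorem energy_antitoneOn (D : Setting F S ε) (hc : CoeffAssumption h r p q hInf rInf pInf qInf)
    {c : ℝ} (hcF : ∀ x, c ≤ F x) (ha : 0 < a) (hz : SolOn F S h r p q ε a b z) :
    AntitoneOn (energy F h ε c z) (Icc a b) := by
  refine antitoneOn_of_deriv_nonpos (convex_Icc a b)
    (energy_continuousOn D (hc.h_cont.mono fun t ht => ha.trans_le ht.1) hz.cont hz.mem c) ?_ ?_
  all_goals
    intro t ht
    rw [interior_Icc] at ht
    have ht0 := ha.trans ht.1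
    obtain ⟨e', he, hle⟩ := energy_hasDerivAt D hc hcF ht0
      (hz.mem t (Ioo_subset_Icc_self ht)) (hz.deriv t ht)
  · exact he.differentiableAt.differentiableWithinAt
  · rw [he.deriv]
    have h1 : 0 ≤ (r t - q t / 4) * kinetic ε (z t) :=
      mul_nonneg (by linarith [hc.r_ge t ht0]) (kinetic_nonneg _ _)
    linarith

theorem Setting.exists_forall_le (D : Setting F S ε) : ∃ x₀, ∀ x, F x₀ ≤ F x :=
  D.F_C1.continuous.exists_forall_le (by rw [← Metric.cobounded_eq_cocompact]; exact D.coercive)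

theorem exists_norm_le_of_continuous {V : Type*} [NormedAddCommGroup V] {Φ : E d → V}
    (hΦ : Continuous Φ) (x₀ : E d) (R : ℝ) : ∃ C, 0 ≤ C ∧ ∀ x, ‖x - x₀‖ ≤ R → ‖Φ x‖ ≤ C := by
  obtain ⟨C, hC⟩ := (isCompact_closedBall x₀ R).exists_bound_of_continuousOn hΦ.continuousOn
  exact ⟨max C 0, le_max_right _ _, fun x hx =>
    le_max_of_le_left (hC x (by rwa [mem_closedBall_iff_norm]))⟩

/-- Solutions are bounded, uniformly with respect to the length of their interval. -/
theorem exists_apriori_bound (D : Setting F S ε)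
    (hc : CoeffAssumption h r p q hInf rInf pInf qInf) (ha : 0 < a) (z₀ : Z d) :
    ∃ R, ∀ b, ∀ z : ℝ → Z d, SolOn F S h r p q ε a b z → z a = z₀ →
      ∀ t ∈ Icc a b, ‖z t‖ ≤ R := by
  obtain ⟨xm, hxm⟩ := D.exists_forall_le
  -- The energy at time `a` sees the trajectory only through its value there, so the constant
  -- trajectory `z₀` gives the initial energy.
  set e₀ := energy F h ε (F xm) (fun _ => z₀) a
  obtain ⟨ρ, hρ⟩ : ∃ ρ, ∀ x, F x ≤ F xm + e₀ / hInf → ‖x‖ ≤ ρ := by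
    have h1 := D.coercive.eventually (eventually_gt_atTop (F xm + e₀ / hInf))
    rw [← comap_norm_atTop, eventually_comap] at h1
    obtain ⟨ρ, hρ⟩ := h1.exists_forall_of_atTop
    exact ⟨ρ, fun x hx => by
      by_contra! hlt
      exact absurd (hρ _ hlt.le x rfl) (not_lt.2 hx)⟩
  obtain ⟨CS, hCS0, hCS⟩ := exists_norm_le_of_continuous D.S_lip.continuous 0 ρ
  obtain ⟨CG, hCG0, hCG⟩ := exists_norm_le_of_continuous D.grad_lip.continuous 0 ρ
  obtain ⟨P, hP⟩ := hc.p_bound ha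
  refine ⟨max (max ‖z₀.1‖ (P / qInf * CS)) (max (max ‖z₀.2.1‖ (h a / rInf * CG)) ρ), ?_⟩
  intro b z hz hza
  have hx : ∀ t ∈ Icc a b, ‖(z t).2.2‖ ≤ ρ := by
    intro t ht
    have ht0 := ha.trans_le ht.1
    have h1 := energy_antitoneOn D hc hxm ha hz ⟨le_rfl, ht.1.trans ht.2⟩ ht ht.1
    have h2 : energy F h ε (F xm) z a = e₀ := by simp only [e₀, energy, hza]
    have h3 : hInf * (F (z t).2.2 - F xm) ≤ e₀ := by
      have h4 : hInf * (F (z t).2.2 - F xm) ≤ h t * (F (z t).2.2 - F xm) :=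
        mul_le_mul_of_nonneg_right (hc.hInf_le ht0) (by linarith [hxm (z t).2.2])
      have h5 := kinetic_nonneg ε (z t)
      rw [h2] at h1
      unfold energy at h1
      linarith
    refine hρ _ ?_
    have : F (z t).2.2 - F xm ≤ e₀ / hInf := by
      rw [le_div_iff₀ hc.hInf_pos]
      linarith
    linarith
  have hv := relaxation_norm_le (c := 0) (R := max ‖z₀.1‖ (P / qInf * CS)) hz.cont.fst
    (fun t ht => hasDerivAt_v (hc.q_pos (ha.trans ht.1)).ne' (hz.deriv t ht))
    (fun t ht => hc.q_nonneg t (ha.trans ht.1))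
    (fun t ht => by
      have ht0 := ha.trans ht.1
      refine le_max_of_le_right ?_
      rw [sub_zero, norm_smul, Real.norm_of_nonneg
        (div_nonneg (hc.p_nonneg t ht0) (hc.q_nonneg t ht0))]
      have h1 : p t / q t ≤ P / qInf :=
        div_le_div₀ ((hc.p_nonneg t ht0).trans (hP t ht.1.le)) (hP t ht.1.le) hc.qInf_pos
          (hc.qInf_le ht0)
      have h2 := hCS _ (by simpa using hx t (Ioo_subset_Icc_self ht))
      exact mul_le_mul h1 h2 (norm_nonneg _)
        ((div_nonneg (hc.p_nonneg t ht0) (hc.q_nonneg t ht0)).trans h1))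
    (by rw [sub_zero, hza]; exact le_max_left _ _)
  have hm := relaxation_norm_le (c := 0) (R := max ‖z₀.2.1‖ (h a / rInf * CG)) hz.cont.snd.fst
    (fun t ht => hasDerivAt_m (hc.r_pos (ha.trans ht.1)).ne' (hz.deriv t ht))
    (fun t ht => hc.r_nonneg t (ha.trans ht.1))
    (fun t ht => by
      have ht0 := ha.trans ht.1
      refine le_max_of_le_right ?_
      rw [sub_zero, norm_smul, Real.norm_of_nonneg
        (div_nonneg (hc.h_nonneg t ht0) (hc.r_nonneg t ht0))]
      have h1 : h t / r t ≤ h a / rInf :=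
        div_le_div₀ (hc.h_nonneg a ha) (hc.h_anti ha ht0 ht.1.le) hc.rInf_pos (hc.rInf_le ht0)
      have h2 := hCG _ (by simpa using hx t (Ioo_subset_Icc_self ht))
      exact mul_le_mul h1 h2 (norm_nonneg _)
        ((div_nonneg (hc.h_nonneg t ht0) (hc.r_nonneg t ht0)).trans h1))
    (by rw [sub_zero, hza]; exact le_max_left _ _)
  intro t ht
  rw [Prod.norm_def, Prod.norm_def]
  exact max_le_max (by simpa using hv t ht) (max_le_max (by simpa using hm t ht) (hx t ht))

end Solutions

end AdamODE

namespace AdamODE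

variable {d : ℕ} {F : E d → ℝ} {S : E d → E d} {h r p q : ℝ → ℝ}
  {ε hInf rInf pInf qInf a b : ℝ} {z : ℝ → Z d}

/-! ### Lipschitz bounds for the vector field -/

theorem exists_lipschitzOn_ball {V : Type*} [NormedAddCommGroup V] {Φ : E d → V}
    (hΦ : LocallyLipschitz Φ) (R : ℝ) :
    ∃ K, 0 ≤ K ∧ ∀ x y, ‖x‖ ≤ R → ‖y‖ ≤ R → ‖Φ x - Φ y‖ ≤ K * ‖x - y‖ := by
  obtain ⟨K, hK⟩ := (hΦ.locallyLipschitzOn (s := Metric.closedBall 0 R)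
    ).exists_lipschitzOnWith_of_compact (isCompact_closedBall 0 R)
  exact ⟨K, K.2, fun x y hx hy => hK.norm_sub_le (by simpa using hx) (by simpa using hy)⟩

/-- At time `t` the coefficients are at most `M`. -/
def CoeffBound (h r p q : ℝ → ℝ) (M t : ℝ) : Prop :=
  |h t| ≤ M ∧ |r t| ≤ M ∧ |p t| ≤ M ∧ |q t| ≤ M

theorem norm_m_le (z : Z d) : ‖z.2.1‖ ≤ ‖z‖ := (norm_fst_le z.2).trans (norm_snd_le z)

theorem norm_x_le (z : Z d) : ‖z.2.2‖ ≤ ‖z‖ := (norm_snd_le z.2).trans (norm_snd_le z)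

theorem norm_smul_sub_smul_le {V : Type*} [NormedAddCommGroup V] [NormedSpace ℝ V] {α β M : ℝ}
    (hα : |α| ≤ M) (hβ : |β| ≤ M) (x y : V) : ‖α • x - β • y‖ ≤ M * ‖x‖ + M * ‖y‖ := by
  refine (norm_sub_le _ _).trans ?_
  rw [norm_smul, norm_smul, Real.norm_eq_abs, Real.norm_eq_abs]
  gcongr

theorem exists_field_lipschitz (D : Setting F S ε) (R : ℝ) {M : ℝ} (hM : 0 ≤ M) :
    ∃ K : NNReal, ∀ t, CoeffBound h r p q M t →
      LipschitzOnWith K (fun z => field F S h r p q ε z t) {z | z ∈ ZPlus d ∧ ‖z‖ ≤ R} := by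
  obtain ⟨KS, hKS0, hKS⟩ := exists_lipschitzOn_ball D.S_lip R
  obtain ⟨KG, hKG0, hKG⟩ := exists_lipschitzOn_ball D.grad_lip R
  have hε := D.ε_pos
  refine ⟨Real.toNNReal (M * KS + M) + Real.toNNReal (M * KG + M) +
    Real.toNNReal ((√ε)⁻¹ + |R| / (ε * √ε)), fun t ht => ?_⟩
  refine LipschitzOnWith.of_dist_le_mul fun z hz z' hz' => ?_
  rw [dist_eq_norm, dist_eq_norm]
  push_cast
  have e1 : 0 ≤ M * KS + M := by positivity
  have e2 : 0 ≤ M * KG + M := by positivity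
  have e3 : 0 ≤ (√ε)⁻¹ + |R| / (ε * √ε) := by positivity
  rw [Real.coe_toNNReal _ e1, Real.coe_toNNReal _ e2, Real.coe_toNNReal _ e3]
  have hv : ‖z.1 - z'.1‖ ≤ ‖z - z'‖ := norm_fst_le (z - z')
  have hm : ‖z.2.1 - z'.2.1‖ ≤ ‖z - z'‖ := norm_m_le (z - z')
  have hx : ‖z.2.2 - z'.2.2‖ ≤ ‖z - z'‖ := norm_x_le (z - z')
  set N := ‖z - z'‖
  have hN : 0 ≤ N := norm_nonneg _
  have hS := hKS _ _ ((norm_x_le z).trans hz.2) ((norm_x_le z').trans hz'.2)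
  have hG := hKG _ _ ((norm_x_le z).trans hz.2) ((norm_x_le z').trans hz'.2)
  have b1 : ‖(field F S h r p q ε z t - field F S h r p q ε z' t).1‖ ≤ (M * KS + M) * N := by
    have : (field F S h r p q ε z t - field F S h r p q ε z' t).1 =
        p t • (S z.2.2 - S z'.2.2) - q t • (z.1 - z'.1) := by
      simp only [field, Prod.fst_sub, smul_sub]
      abel
    rw [this]
    calc _ ≤ M * ‖S z.2.2 - S z'.2.2‖ + M * ‖z.1 - z'.1‖ :=
          norm_smul_sub_smul_le ht.2.2.1 ht.2.2.2 _ _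
      _ ≤ M * (KS * N) + M * N := by gcongr; exact hS.trans (by gcongr)
      _ = (M * KS + M) * N := by ring
  have b2 : ‖(field F S h r p q ε z t - field F S h r p q ε z' t).2.1‖ ≤ (M * KG + M) * N := by
    have : (field F S h r p q ε z t - field F S h r p q ε z' t).2.1 =
        h t • (gradient F z.2.2 - gradient F z'.2.2) - r t • (z.2.1 - z'.2.1) := by
      simp only [field, Prod.fst_sub, Prod.snd_sub, smul_sub]
      abel
    rw [this]
    calc _ ≤ M * ‖gradient F z.2.2 - gradient F z'.2.2‖ + M * ‖z.2.1 - z'.2.1‖ :=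
          norm_smul_sub_smul_le ht.1 ht.2.1 _ _
      _ ≤ M * (KG * N) + M * N := by gcongr; exact hG.trans (by gcongr)
      _ = (M * KG + M) * N := by ring
  have b3 : ‖(field F S h r p q ε z t - field F S h r p q ε z' t).2.2‖ ≤
      ((√ε)⁻¹ + |R| / (ε * √ε)) * N := by
    have h1 := norm_velocity_sub_le (m := z.2.1) hε hz.1 hz'.1
      (((norm_m_le z').trans hz'.2).trans (le_abs_self R))
    calc _ ≤ (√ε)⁻¹ * ‖z.2.1 - z'.2.1‖ + |R| / (ε * √ε) * ‖z.1 - z'.1‖ := h1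
      _ ≤ (√ε)⁻¹ * N + |R| / (ε * √ε) * N := by gcongr
      _ = _ := by ring
  rw [Prod.norm_def, Prod.norm_def]
  refine max_le (b1.trans ?_) (max_le (b2.trans ?_) (b3.trans ?_)) <;>
    exact mul_le_mul_of_nonneg_right (by linarith) hN

theorem exists_field_bound (D : Setting F S ε) (R : ℝ) {M : ℝ} (hM : 0 ≤ M) :
    ∃ L : NNReal, ∀ t, CoeffBound h r p q M t → ∀ z ∈ ZPlus d, ‖z‖ ≤ R →
      ‖field F S h r p q ε z t‖ ≤ L := by
  obtain ⟨CS, hCS0, hCS⟩ := exists_norm_le_of_continuous D.S_lip.continuous 0 R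
  obtain ⟨CG, hCG0, hCG⟩ := exists_norm_le_of_continuous D.grad_lip.continuous 0 R
  refine ⟨Real.toNNReal (max (M * CS + M * R) (max (M * CG + M * R) (R / √ε))),
    fun t ht z hz hzR => (le_trans ?_ (Real.le_coe_toNNReal _))⟩
  rw [Prod.norm_def, Prod.norm_def]
  refine max_le_max ?_ (max_le_max ?_ ?_)
  · refine (norm_smul_sub_smul_le ht.2.2.1 ht.2.2.2 _ _).trans ?_
    have := hCS z.2.2 (by simpa using (norm_x_le z).trans hzR)
    have := (norm_fst_le z).trans hzR
    gcongr
  · refine (norm_smul_sub_smul_le ht.1 ht.2.1 _ _).trans ?_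
    have := hCG z.2.2 (by simpa using (norm_x_le z).trans hzR)
    have := (norm_m_le z).trans hzR
    gcongr
  · refine (norm_velocity_le D.ε_pos hz z.2.1).trans ?_
    have := (norm_m_le z).trans hzR
    gcongr

theorem CoeffAssumption.exists_coeffBound (hc : CoeffAssumption h r p q hInf rInf pInf qInf)
    (ha : 0 < a) : ∃ M, 0 ≤ M ∧ ∀ t ≥ a, CoeffBound h r p q M t := by
  obtain ⟨P, hP⟩ := hc.p_bound ha
  have hP0 : 0 ≤ P := (hc.p_nonneg a ha).trans (hP a le_rfl)
  have h1 := hc.h_nonneg a ha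
  have h2 := hc.r_nonneg a ha
  have h3 := hc.q_nonneg a ha
  refine ⟨h a + r a + P + q a, by positivity, fun t ht => ?_⟩
  have ht0 := ha.trans_le ht
  refine ⟨?_, ?_, ?_, ?_⟩
  · rw [abs_of_nonneg (hc.h_nonneg t ht0)]
    linarith [hc.h_anti ha ht0 ht]
  · rw [abs_of_nonneg (hc.r_nonneg t ht0)]
    linarith [hc.r_anti ha ht0 ht]
  · rw [abs_of_nonneg (hc.p_nonneg t ht0)]
    linarith [hP t ht]
  · rw [abs_of_nonneg (hc.q_nonneg t ht0)]
    linarith [hc.q_anti ha ht0 ht]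

/-! ### Continuous dependence and uniqueness for positive starting times -/

/-- Grönwall's inequality on `[s, b]`, followed by `s → a`: `SolOn` gives derivatives only in the
open interval, so the estimate cannot start at `a` itself. -/
theorem exists_stability (D : Setting F S ε)
    (hc : CoeffAssumption h r p q hInf rInf pInf qInf) (ha : 0 < a) (b R : ℝ) :
    ∃ C, ∀ y z : ℝ → Z d, SolOn F S h r p q ε a b y → SolOn F S h r p q ε a b z →
      (∀ t ∈ Icc a b, ‖y t‖ ≤ R) → (∀ t ∈ Icc a b, ‖z t‖ ≤ R) →
      ∀ t ∈ Icc a b, ‖y t - z t‖ ≤ ‖y a - z a‖ * C := by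
  obtain ⟨M, hM0, hM⟩ := hc.exists_coeffBound ha
  obtain ⟨K, hK⟩ := exists_field_lipschitz (h := h) (r := r) (p := p) (q := q) D R hM0
  refine ⟨Real.exp (K * (b - a)), fun y z hy hz hyR hzR t ht => ?_⟩
  rcases eq_or_lt_of_le ht.1 with rfl | hat
  · refine le_mul_of_one_le_right (norm_nonneg _) (Real.one_le_exp ?_)
    exact mul_nonneg K.2 (by linarith [ht.2])
  have hlim : Tendsto (fun s => ‖y s - z s‖ * Real.exp (K * (b - a))) (𝓝[>] a)
      (𝓝 (‖y a - z a‖ * Real.exp (K * (b - a)))) := by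
    have hab : a ∈ Icc a b := ⟨le_rfl, ht.1.trans ht.2⟩
    have h1 := (((hy.cont.sub hz.cont).norm) a hab).mul_const (Real.exp (K * (b - a)))
    exact h1.tendsto.mono_left (nhdsWithin_le_of_mem
      (Icc_mem_nhdsGT (hat.trans_le ht.2)))
  refine ge_of_tendsto hlim ?_
  filter_upwards [Ioo_mem_nhdsGT hat] with s hs
  have hsub : Icc s b ⊆ Icc a b := Icc_subset_Icc_left hs.1.le
  have hIoo : ∀ u ∈ Ico s b, u ∈ Ioo a b := fun u hu => ⟨hs.1.trans_le hu.1, hu.2⟩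
  have key := dist_le_of_trajectories_ODE_of_mem (v := fun t z => field F S h r p q ε z t)
    (s := fun _ => {z | z ∈ ZPlus d ∧ ‖z‖ ≤ R}) (K := K) (f := y) (g := z) (a := s) (b := b)
    (fun u hu => hK u (hM u (hs.1.le.trans hu.1))) (hy.cont.mono hsub)
    (fun u hu => (hy.deriv u (hIoo u hu)).hasDerivWithinAt)
    (fun u hu => ⟨hy.mem u (Ioo_subset_Icc_self (hIoo u hu)),
      hyR u (Ioo_subset_Icc_self (hIoo u hu))⟩) (hz.cont.mono hsub)
    (fun u hu => (hz.deriv u (hIoo u hu)).hasDerivWithinAt)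
    (fun u hu => ⟨hz.mem u (Ioo_subset_Icc_self (hIoo u hu)),
      hzR u (Ioo_subset_Icc_self (hIoo u hu))⟩) le_rfl t ⟨hs.2.le, ht.2⟩
  rw [dist_eq_norm, dist_eq_norm] at key
  refine key.trans ?_
  gcongr
  · exact ht.2
  · exact hs.1.le

theorem SolOn.exists_bound (hz : SolOn F S h r p q ε a b z) : ∃ R, ∀ t ∈ Icc a b, ‖z t‖ ≤ R :=
  isCompact_Icc.exists_bound_of_continuousOn hz.cont

theorem SolOn.eqOn (D : Setting F S ε) (hc : CoeffAssumption h r p q hInf rInf pInf qInf)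
    (ha : 0 < a) {y : ℝ → Z d} (hy : SolOn F S h r p q ε a b y)
    (hz : SolOn F S h r p q ε a b z) (hyz : y a = z a) : EqOn y z (Icc a b) := by
  obtain ⟨R₁, h₁⟩ := hy.exists_bound
  obtain ⟨R₂, h₂⟩ := hz.exists_bound
  obtain ⟨C, hC⟩ := exists_stability D hc ha b (max R₁ R₂)
  intro t ht
  have := hC y z hy hz (fun t ht => le_max_of_le_left (h₁ t ht))
    (fun t ht => le_max_of_le_right (h₂ t ht)) t ht
  rw [hyz, sub_self, norm_zero, zero_mul] at this
  exact sub_eq_zero.1 (norm_le_zero_iff.1 this)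

/-! ### Existence for positive starting times -/

/-- Coordinatewise truncation to the interval `[lo, hi]`. -/
noncomputable def clampE (lo hi : ℝ) (x : E d) : E d :=
  WithLp.toLp 2 fun i => max lo (min hi (x i))

theorem norm_clampE_sub_le (lo hi : ℝ) (x y : E d) :
    ‖clampE lo hi x - clampE lo hi y‖ ≤ ‖x - y‖ := by
  refine norm_le_norm_of_abs_le fun i => ?_
  simp only [clampE, PiLp.sub_apply]
  refine (abs_max_sub_max_le_max _ _ _ _).trans ?_
  rw [sub_self, abs_zero, max_eq_right (abs_nonneg _)]
  refine (abs_min_sub_min_le_max _ _ _ _).trans ?_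
  rw [sub_self, abs_zero, max_eq_right (abs_nonneg _)]

theorem norm_clampE_le {lo hi R : ℝ} (hlo : -R ≤ lo) (hlo' : lo ≤ R) (hhi : hi ≤ R) (x : E d) :
    ‖clampE lo hi x‖ ≤ ‖(WithLp.toLp 2 fun _ => R : E d)‖ := by
  refine norm_le_norm_of_abs_le fun i => ?_
  simp only [clampE]
  refine le_trans (abs_le.2 ⟨?_, ?_⟩) (le_abs_self R)
  · exact hlo.trans (le_max_left _ _)
  · exact max_le hlo' ((min_le_left _ _).trans hhi)

theorem clampE_eq_self {lo hi : ℝ} {x : E d} (hx : ∀ i, x i ∈ Icc lo hi) : clampE lo hi x = x := by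
  ext i
  simp [clampE, (hx i).1, (hx i).2]

/-- Truncation of the state space to a bounded part of `ZPlus`. -/
noncomputable def clampZ (R : ℝ) (z : Z d) : Z d :=
  (clampE 0 R z.1, clampE (-R) R z.2.1, clampE (-R) R z.2.2)

theorem clampZ_lipschitz (R : ℝ) : LipschitzWith 1 (clampZ R : Z d → Z d) := by
  refine LipschitzWith.of_dist_le_mul fun z z' => ?_
  rw [dist_eq_norm, dist_eq_norm, NNReal.coe_one, one_mul, Prod.norm_def, Prod.norm_def]
  exact max_le ((norm_clampE_sub_le _ _ _ _).trans (norm_fst_le (z - z')))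
    (max_le ((norm_clampE_sub_le _ _ _ _).trans (norm_m_le (z - z')))
      ((norm_clampE_sub_le _ _ _ _).trans (norm_x_le (z - z'))))

theorem clampZ_mem (R : ℝ) (z : Z d) : clampZ R z ∈ ZPlus d := fun _ => le_max_left _ _

theorem norm_clampZ_le {R : ℝ} (hR : 0 ≤ R) (z : Z d) :
    ‖clampZ R z‖ ≤ ‖(WithLp.toLp 2 fun _ => R : E d)‖ := by
  rw [Prod.norm_def, Prod.norm_def]
  exact max_le (norm_clampE_le (by linarith) hR le_rfl _)
    (max_le (norm_clampE_le le_rfl (by linarith) le_rfl _)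
      (norm_clampE_le le_rfl (by linarith) le_rfl _))

theorem clampZ_eq_self {R : ℝ} {z : Z d} (hz : z ∈ ZPlus d) (hR : ‖z‖ ≤ R) : clampZ R z = z := by
  have h1 := clampE_eq_self (x := z.1) (lo := 0) (hi := R) fun i =>
    ⟨hz i, (le_abs_self _).trans ((abs_coord_le z.1 i).trans ((norm_fst_le z).trans hR))⟩
  have h2 := clampE_eq_self (x := z.2.1) (lo := -R) (hi := R) fun i =>
    abs_le.1 ((abs_coord_le z.2.1 i).trans ((norm_m_le z).trans hR))
  have h3 := clampE_eq_self (x := z.2.2) (lo := -R) (hi := R) fun i =>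
    abs_le.1 ((abs_coord_le z.2.2 i).trans ((norm_x_le z).trans hR))
  rw [clampZ, h1, h2, h3]

theorem field_continuousOn_time {s : Set ℝ} (hh : ContinuousOn h s) (hr : ContinuousOn r s)
    (hp : ContinuousOn p s) (hq : ContinuousOn q s) (z : Z d) :
    ContinuousOn (fun t => field F S h r p q ε z t) s := by
  unfold field
  fun_prop

/-- The truncated field is globally Lipschitz and bounded by some `L`, so the ball of radius `L (b -
a)` serves Picard-Lindelöf on all of `[a, b]` at once. -/
theorem exists_truncated_solution (D : Setting F S ε)
    (hc : CoeffAssumption h r p q hInf rInf pInf qInf) (ha : 0 < a) (hab : a ≤ b) (z₀ : Z d)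
    {R : ℝ} (hR : 0 ≤ R) :
    ∃ z : ℝ → Z d, z a = z₀ ∧ ∀ t ∈ Icc a b,
      HasDerivWithinAt z (field F S h r p q ε (clampZ R (z t)) t) (Icc a b) t := by
  obtain ⟨M, hM0, hM⟩ := hc.exists_coeffBound ha
  set R' := ‖(WithLp.toLp 2 fun _ => R : E d)‖
  obtain ⟨K, hK⟩ := exists_field_lipschitz (h := h) (r := r) (p := p) (q := q) D R' hM0
  obtain ⟨L, hL⟩ := exists_field_bound (h := h) (r := r) (p := p) (q := q) D R' hM0
  have hsub : Icc a b ⊆ Ioi 0 := fun t ht => ha.trans_le ht.1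
  have hPL : IsPicardLindelof (fun t z => field F S h r p q ε (clampZ R z) t)
      (⟨a, le_rfl, hab⟩ : Icc a b) z₀ (L * Real.toNNReal (b - a)) 0 L K :=
    { lipschitzOnWith := fun t ht => by
        have h1 := (hK t (hM t ht.1)).comp (clampZ_lipschitz R).lipschitzOnWith
          (s := Metric.closedBall z₀ ↑(L * Real.toNNReal (b - a)))
          (fun z _ => ⟨clampZ_mem R z, norm_clampZ_le hR z⟩)
        rwa [mul_one] at h1
      continuousOn := fun x _ => field_continuousOn_time (hc.h_cont.mono hsub)
        (hc.r_cont.mono hsub) (hc.p_cont.mono hsub) (hc.q_cont.mono hsub) _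
      norm_le := fun t ht x _ => hL t (hM t ht.1) _ (clampZ_mem R x) (norm_clampZ_le hR x)
      mul_max_le := by
        simp [Real.coe_toNNReal _ (sub_nonneg.2 hab), hab] }
  exact hPL.exists_eq_forall_mem_Icc_hasDerivWithinAt₀

theorem exists_solution_Icc (D : Setting F S ε)
    (hc : CoeffAssumption h r p q hInf rInf pInf qInf) (ha : 0 < a) (hab : a ≤ b) {z₀ : Z d}
    (hz₀ : z₀ ∈ ZPlus d) :
    ∃ z : ℝ → Z d, z a = z₀ ∧ (∀ t ∈ Icc a b, z t ∈ ZPlus d) ∧ ∀ t ∈ Icc a b,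
      HasDerivWithinAt z (field F S h r p q ε (z t) t) (Icc a b) t := by
  obtain ⟨R, hR⟩ := exists_apriori_bound D hc ha z₀
  -- Truncating one unit above the a priori bound leaves the strict gap needed by the continuity
  -- argument: until the truncation acts `z` is a true solution, so its norm stays at most `|R|` and
  -- the truncation never acts.
  obtain ⟨z, hza, hz⟩ := exists_truncated_solution D hc ha hab z₀ (R := |R| + 1) (by positivity)
  have hcont : ContinuousOn z (Icc a b) := fun t ht => (hz t ht).continuousWithinAt
  have hder : ∀ t ∈ Ioo a b,
      HasDerivAt z (field F S h r p q ε (clampZ (|R| + 1) (z t)) t) t := fun t ht =>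
    (hz t (Ioo_subset_Icc_self ht)).hasDerivAt (Icc_mem_nhds ht.1 ht.2)
  have hmem : ∀ t ∈ Icc a b, z t ∈ ZPlus d := by
    intro t ht i
    -- Where `v_i < 0` its truncation is `0`, the damping disappears and `v_i' = p S_i ≥ 0`.
    have key := nonpos_of_deriv_nonpos_of_pos (f := fun t => -(z t).1 i)
      (((EuclideanSpace.proj i : E d →L[ℝ] ℝ).continuous.comp_continuousOn hcont.fst).neg)
      (fun t ht => (hasDerivAt_coord (hder t ht).fst i).neg)
      (by rw [hza]; exact neg_nonpos.2 (hz₀ i)) (fun t ht hpos => by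
        have ht0 := ha.trans ht.1
        have h1 : (clampZ (|R| + 1) (z t)).1 i = 0 :=
          max_eq_left ((min_le_right _ _).trans (by linarith))
        simp only [field, PiLp.sub_apply, PiLp.smul_apply, h1, smul_eq_mul, mul_zero, sub_zero]
        exact neg_nonpos.2 (mul_nonneg (hc.p_nonneg t ht0) (D.S_nonneg _ i))) t ht
    exact neg_nonpos.1 key
  have hbound : ∀ t ∈ Icc a b, ‖z t‖ ≤ |R| := by
    refine le_of_forall_Ico_le_imp_le hcont.norm (lt_add_one |R|) fun t ht hle => ?_
    refine (hR t z ⟨hcont.mono (Icc_subset_Icc_right ht.2), fun u hu =>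
      hmem u (Icc_subset_Icc_right ht.2 hu), fun u hu => ?_⟩ hza t ⟨ht.1, le_rfl⟩).trans
      (le_abs_self R)
    have hu : u ∈ Ioo a b := Ioo_subset_Ioo_right ht.2 hu
    have := hder u hu
    rwa [clampZ_eq_self (hmem u (Ioo_subset_Icc_self hu)) (hle u ⟨hu.1.le, by grind⟩)] at this
  refine ⟨z, hza, hmem, fun t ht => ?_⟩
  have := hz t ht
  rwa [clampZ_eq_self (hmem t ht) (by linarith [hbound t ht])] at this

theorem exists_isSolution (D : Setting F S ε)
    (hc : CoeffAssumption h r p q hInf rInf pInf qInf) (ha : 0 < a) {z₀ : Z d}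
    (hz₀ : z₀ ∈ ZPlus d) : ∃ z : ℝ → Z d, IsSolution F S h r p q ε a z₀ z := by
  have hex : ∀ n : ℕ, ∃ z : ℝ → Z d, z a = z₀ ∧ (∀ t ∈ Icc a (a + n + 1), z t ∈ ZPlus d) ∧
      ∀ t ∈ Icc a (a + n + 1),
        HasDerivWithinAt z (field F S h r p q ε (z t) t) (Icc a (a + n + 1)) t := fun n =>
    exists_solution_Icc D hc ha (by have : (0 : ℝ) ≤ n := n.cast_nonneg; linarith) hz₀
  choose w hwa hwmem hw using hex
  have hsol : ∀ n : ℕ, SolOn F S h r p q ε a (a + n + 1) (w n) := fun n =>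
    ⟨fun t ht => (hw n t ht).continuousWithinAt, hwmem n, fun t ht =>
      (hw n t (Ioo_subset_Icc_self ht)).hasDerivAt (Icc_mem_nhds ht.1 ht.2)⟩
  -- By uniqueness the pieces agree on overlaps. Piece `n` lives on `[a, a + n + 1]`; the extra `1`
  -- keeps `t` off its right end, as the derivative within `[a, ∞)` requires.
  set z : ℝ → Z d := fun t => w ⌈t - a⌉₊ t with hzdef
  have hzw : ∀ n : ℕ, EqOn z (w n) (Icc a (a + n + 1)) := by
    intro n t ht
    have h1 := Nat.le_ceil (t - a)
    exact SolOn.eqOn D hc ha ((hsol _).mono le_rfl (show t ≤ a + ⌈t - a⌉₊ + 1 by linarith))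
      ((hsol n).mono le_rfl ht.2) ((hwa _).trans (hwa n).symm) ⟨ht.1, le_rfl⟩
  have hIcc : ∀ t ≥ a, t ∈ Icc a (a + (⌈t - a⌉₊ : ℕ) + 1) := fun t ht =>
    ⟨ht, by have := Nat.le_ceil (t - a); linarith⟩
  have hder : ∀ t ∈ Ici a, HasDerivWithinAt z (field F S h r p q ε (z t) t) (Ici a) t := by
    intro t ht
    set n := ⌈t - a⌉₊ with hn
    have h1 := (hw n t (hIcc t ht)).congr (hzw n) rfl
    refine h1.mono_of_mem_nhdsWithin ?_
    rw [← Ici_inter_Iic]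
    refine inter_mem self_mem_nhdsWithin (mem_nhdsWithin_of_mem_nhds (Iic_mem_nhds ?_))
    have := Nat.le_ceil (t - a)
    linarith
  refine ⟨z, ?_, fun t ht => (hder t ht).continuousWithinAt, fun t ht => hwmem _ t (hIcc t ht),
    fun t ht _ => hder t ht⟩
  simp [hzdef, hwa]

theorem IsSolution.eqOn (D : Setting F S ε) (hc : CoeffAssumption h r p q hInf rInf pInf qInf)
    (ha : 0 < a) {y : ℝ → Z d} {y₀ z₀ : Z d} {a₁ a₂ : ℝ}
    (hy : IsSolution F S h r p q ε a₁ y₀ y) (hz : IsSolution F S h r p q ε a₂ z₀ z)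
    (h₁ : 0 ≤ a₁) (h₂ : 0 ≤ a₂) (h₁a : a₁ ≤ a) (h₂a : a₂ ≤ a) (hyz : y a = z a) :
    EqOn y z (Ici a) := fun t ht =>
  SolOn.eqOn D hc ha (hy.solOn h₁ h₁a t) (hz.solOn h₂ h₂a t) hyz ⟨ht, le_rfl⟩

theorem IsSolution.isBounded (D : Setting F S ε)
    (hc : CoeffAssumption h r p q hInf rInf pInf qInf) (ha : 0 < a) {z₀ : Z d}
    (hz : IsSolution F S h r p q ε a z₀ z) : ∃ R, ∀ t ≥ a, ‖z t‖ ≤ R := by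
  obtain ⟨R, hR⟩ := exists_apriori_bound D hc ha z₀
  exact ⟨R, fun t ht => hR t z (hz.solOn ha.le le_rfl t) hz.init t ⟨ht, le_rfl⟩⟩

end AdamODE

namespace AdamODE

variable {d : ℕ} {F : E d → ℝ} {S : E d → E d} {h r p q : ℝ → ℝ}
  {ε hInf rInf pInf qInf a b : ℝ} {z : ℝ → Z d}

/-! ### Convergence for positive starting times -/

/-! ### Slowly varying functions and tracking. -/

section Tracking

variable {V : Type*} [NormedAddCommGroup V]

theorem SlowlyVarying.add {f g : ℝ → V} (hf : SlowlyVarying f) (hg : SlowlyVarying g) :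
    SlowlyVarying fun t => f t + g t := by
  intro L hL δ hδ
  filter_upwards [hf L hL (δ / 2) (by positivity), hg L hL (δ / 2) (by positivity)]
    with t h1 h2 u hu
  calc ‖f u + g u - (f t + g t)‖ = ‖(f u - f t) + (g u - g t)‖ := by congr 1; abel
    _ ≤ ‖f u - f t‖ + ‖g u - g t‖ := norm_add_le _ _
    _ ≤ δ := by linarith [h1 u hu, h2 u hu]

theorem slowlyVarying_of_tendsto_zero {f : ℝ → V} (hf : Tendsto f atTop (𝓝 0)) :
    SlowlyVarying f := by
  intro L hL δ hδ
  obtain ⟨T, hT⟩ := (Metric.tendsto_atTop.1 hf) (δ / 2) (by positivity)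
  filter_upwards [eventually_ge_atTop T] with t ht u hu
  have h1 := hT t ht
  have h2 := hT u (le_trans ht hu.1)
  rw [dist_zero_right] at h1 h2
  linarith [norm_sub_le (f u) (f t)]

theorem SlowlyVarying.comp_continuous {x : ℝ → E d} (hx : SlowlyVarying x) {Φ : E d → V}
    (hΦ : Continuous Φ) {T R : ℝ} (hxR : ∀ t > T, ‖x t‖ ≤ R) :
    SlowlyVarying fun t => Φ (x t) := by
  intro L hL δ hδ
  have huc := (isCompact_closedBall (0 : E d) R).uniformContinuousOn_of_continuous
    hΦ.continuousOn
  obtain ⟨η, hη, hηδ⟩ := Metric.uniformContinuousOn_iff.1 huc δ hδ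
  filter_upwards [hx L hL (η / 2) (by positivity), eventually_gt_atTop T] with t h1 ht u hu
  rw [← dist_eq_norm]
  refine (hηδ _ (by simpa using hxR u (ht.trans_le hu.1)) _ (by simpa using hxR t ht) ?_).le
  rw [dist_eq_norm]
  linarith [h1 u hu]

variable [InnerProductSpace ℝ V]

/-- Solutions of `y' = ρ (A Φ(x) - y)` track `AInf Φ(x)` when `x` varies slowly and `A → AInf`. -/
theorem tendsto_sub_smul_of_slowlyVarying {x : ℝ → E d} (hx : SlowlyVarying x) {Φ : E d → V}
    (hΦ : Continuous Φ) {T R κ AInf : ℝ} (hxR : ∀ t > T, ‖x t‖ ≤ R) {A ρ : ℝ → ℝ} {y : ℝ → V}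
    (hA : Tendsto A atTop (𝓝 AInf)) (hκ : 0 < κ) (hρ : ∀ t > T, κ ≤ ρ t)
    (hyR : ∀ t > T, ‖y t‖ ≤ R) (hd : ∀ t > T, HasDerivAt y (ρ t • (A t • Φ (x t) - y t)) t) :
    Tendsto (fun t => y t - AInf • Φ (x t)) atTop (𝓝 0) := by
  obtain ⟨C, hC0, hC⟩ := exists_norm_le_of_continuous hΦ 0 R
  have hΦC : ∀ t > T, ‖Φ (x t)‖ ≤ C := fun t ht => hC _ (by simpa using hxR t ht)
  -- Replacing `A t` by its limit costs a vanishing term, since `Φ (x t)` is bounded.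
  have hdiff : Tendsto (fun t => (A t - AInf) • Φ (x t)) atTop (𝓝 0) := by
    have h1 : Tendsto (fun t => |A t - AInf| * C) atTop (𝓝 0) := by
      simpa using ((hA.sub_const AInf).abs).mul_const C
    refine squeeze_zero_norm' ?_ h1
    filter_upwards [eventually_gt_atTop T] with t ht
    rw [norm_smul, Real.norm_eq_abs]
    exact mul_le_mul_of_nonneg_left (hΦC t ht) (abs_nonneg _)
  have hw : SlowlyVarying fun t => A t • Φ (x t) := by
    have h1 := ((hx.comp_continuous (hΦ.const_smul AInf) hxR).add
      (slowlyVarying_of_tendsto_zero hdiff))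
    have h2 : (fun t => AInf • Φ (x t) + (A t - AInf) • Φ (x t)) = fun t => A t • Φ (x t) := by
      funext t
      rw [← add_smul, add_sub_cancel]
    rw [← h2]
    exact h1
  obtain ⟨T', hT'⟩ := (hA.abs.eventually (gt_mem_nhds (lt_add_one |AInf|))).exists_forall_of_atTop
  have key := tendsto_sub_of_slowlyVarying (T := max T T') (R := max R ((|AInf| + 1) * C))
    (fun t ht => hd t ((le_max_left _ _).trans_lt ht)) hκ
    (fun t ht => hρ t ((le_max_left _ _).trans_lt ht))
    (fun t ht => le_max_of_le_left (hyR t ((le_max_left _ _).trans_lt ht)))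
    (fun t ht => le_max_of_le_right (by
      rw [norm_smul, Real.norm_eq_abs]
      exact mul_le_mul (hT' t ((le_max_right _ _).trans ht.le)).le
        (hΦC t ((le_max_left _ _).trans_lt ht)) (norm_nonneg _) (by positivity))) hw
  have h3 := key.add hdiff
  rw [add_zero] at h3
  refine h3.congr fun t => ?_
  rw [sub_smul]
  abel

end Tracking

theorem Setting.exists_critical (D : Setting F S ε) : ∃ x, gradient F x = 0 := by
  obtain ⟨x, hx⟩ := D.exists_forall_le
  refine ⟨x, ?_⟩
  have h1 : IsLocalMin F x := Eventually.of_forall hx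
  rw [gradient, h1.fderiv_eq_zero, map_zero]

theorem IsSolution.hasDerivAt {z₀ : Z d} (hz : IsSolution F S h r p q ε a z₀ z) (ha : 0 < a)
    {t : ℝ} (ht : a < t) : HasDerivAt z (field F S h r p q ε (z t) t) t :=
  (hz.eqn t ht.le (ha.trans ht)).hasDerivAt (Ici_mem_nhds ht)

/-- The mean value inequality without a derivative at the left end, which is reached by continuity.
-/
theorem norm_sub_le_of_hasDerivAt {V : Type*} [NormedAddCommGroup V] [NormedSpace ℝ V]
    {y y' : ℝ → V} {s t C : ℝ} (hy : ContinuousOn y (Icc s t))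
    (hd : ∀ u ∈ Ioo s t, HasDerivAt y (y' u) u) (hC : ∀ u ∈ Ioo s t, ‖y' u‖ ≤ C)
    (hst : s ≤ t) : ‖y t - y s‖ ≤ C * (t - s) := by
  rcases eq_or_lt_of_le hst with rfl | hlt
  · simp
  have hlim : Tendsto (fun u => ‖y t - y u‖) (𝓝[>] s) (𝓝 ‖y t - y s‖) :=
    ((((continuousOn_const.sub hy).norm) s ⟨le_rfl, hst⟩).tendsto).mono_left
      (nhdsWithin_le_of_mem (Icc_mem_nhdsGT hlt))
  have hlim' : Tendsto (fun u => C * (t - u)) (𝓝[>] s) (𝓝 (C * (t - s))) := by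
    have : Continuous fun u : ℝ => C * (t - u) := by fun_prop
    exact this.continuousAt.tendsto.mono_left nhdsWithin_le_nhds
  refine le_of_tendsto_of_tendsto hlim hlim' ?_
  filter_upwards [Ioo_mem_nhdsGT hlt] with u hu
  exact norm_image_sub_le_of_norm_deriv_right_le_segment
    (hy.mono (Icc_subset_Icc_left hu.1.le))
    (fun v hv => (hd v ⟨hu.1.trans_le hv.1, hv.2⟩).hasDerivWithinAt)
    (fun v hv => hC v ⟨hu.1.trans_le hv.1, hv.2⟩) t ⟨hu.2.le, le_rfl⟩

theorem norm_sq_le_mul_kinetic {R : ℝ} (hε : 0 < ε) {z : Z d} (hz : z ∈ ZPlus d) (hR : ‖z‖ ≤ R) :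
    (√(R + ε))⁻¹ * ‖z.2.1‖ ^ 2 ≤ kinetic ε z := by
  rw [EuclideanSpace.norm_sq_eq, Finset.mul_sum, kinetic]
  refine Finset.sum_le_sum fun i _ => ?_
  have h1 : z.1 i ≤ R := (le_abs_self _).trans ((abs_coord_le z.1 i).trans ((norm_fst_le z).trans hR))
  have h2 : 0 < √(z.1 i + ε) := Real.sqrt_pos.2 (by have := hz i; linarith)
  rw [div_eq_inv_mul, Real.norm_eq_abs, sq_abs]
  gcongr

/-- On a bounded orbit the energy loses at least a constant times `‖m‖²`. This quantity is Lipschitz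
in time because the field is bounded along the orbit, so it tends to `0`. -/
theorem IsSolution.tendsto_m (D : Setting F S ε)
    (hc : CoeffAssumption h r p q hInf rInf pInf qInf) (ha : 0 < a) {z₀ : Z d}
    (hz : IsSolution F S h r p q ε a z₀ z) : Tendsto (fun t => (z t).2.1) atTop (𝓝 0) := by
  obtain ⟨R, hR⟩ := hz.isBounded D hc ha
  obtain ⟨M, hM0, hM⟩ := hc.exists_coeffBound ha
  obtain ⟨L, hL⟩ := exists_field_bound (h := h) (r := r) (p := p) (q := q) D R hM0
  obtain ⟨xm, hxm⟩ := D.exists_forall_le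
  have hε := D.ε_pos
  have hR0 : 0 ≤ R := (norm_nonneg _).trans (hR a le_rfl)
  set c₀ := (rInf - qInf / 4) / 2 with hc₀
  have hc₀pos : 0 < c₀ := by have := hc.rInf_gt; rw [hc₀]; linarith
  have hlim : Tendsto (fun t => r t - q t / 4) atTop (𝓝 (rInf - qInf / 4)) :=
    hc.r_lim.sub (hc.q_lim.div_const 4)
  obtain ⟨T, hT⟩ := (hlim.eventually (lt_mem_nhds (show c₀ < rInf - qInf / 4 by
    have := hc.rInf_gt; rw [hc₀]; linarith))).exists_forall_of_atTop
  have hder : ∀ t, ∃ e', a < t → HasDerivAt (energy F h ε (F xm) z) e' t ∧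
      e' ≤ -((r t - q t / 4) * kinetic ε (z t)) := by
    intro t
    by_cases ht : a < t
    · obtain ⟨e', he⟩ := energy_hasDerivAt D hc hxm (ha.trans ht) (hz.mem t ht.le)
        (hz.hasDerivAt ha ht)
      exact ⟨e', fun _ => he⟩
    · exact ⟨0, fun h => absurd h ht⟩
  choose e' he' using hder
  have hLip : ∀ t > a, ∀ u ≥ t, ‖z u - z t‖ ≤ L * (u - t) := fun t ht u hu =>
    norm_sub_le_of_hasDerivAt (hz.cont.mono fun s hs => ht.le.trans hs.1)
      (fun s hs => hz.hasDerivAt ha (lt_trans ht hs.1))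
      (fun s hs => hL s (hM s (ht.le.trans hs.1.le)) _ (hz.mem s (ht.le.trans hs.1.le))
        (hR s (ht.le.trans hs.1.le))) hu
  have key := tendsto_zero_of_dissipation (T := max a T) (e := energy F h ε (F xm) z)
    (g := fun t => ‖(z t).2.1‖ ^ 2) (c := c₀ * (√(R + ε))⁻¹) (m := 0) (K := 2 * R * L)
    (by positivity) (fun t ht => (he' t ((le_max_left _ _).trans_lt ht)).1) (fun t ht => ?_)
    (fun t ht => ?_) (fun t _ => by positivity) (fun t ht u hu => ?_)
  · rw [tendsto_zero_iff_norm_tendsto_zero]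
    have h1 := key.sqrt
    simpa [Real.sqrt_sq (norm_nonneg _)] using h1
  · have hat : a < t := (le_max_left _ _).trans_lt ht
    refine (he' t hat).2.trans (neg_le_neg ?_)
    have h1 := norm_sq_le_mul_kinetic hε (hz.mem t hat.le) (hR t hat.le)
    rw [mul_assoc]
    exact mul_le_mul (hT t ((le_max_right _ _).trans ht.le)).le h1 (by positivity)
      (hc₀pos.le.trans (hT t ((le_max_right _ _).trans ht.le)).le)
  · have hat : a < t := (le_max_left _ _).trans_lt ht
    have h1 := kinetic_nonneg ε (z t)
    have h2 : 0 ≤ h t * (F (z t).2.2 - F xm) :=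
      mul_nonneg (hc.h_nonneg t (ha.trans hat)) (by linarith [hxm (z t).2.2])
    unfold energy
    linarith
  · have hat : a < t := (le_max_left _ _).trans_lt ht
    have h1 : |‖(z u).2.1‖ - ‖(z t).2.1‖| ≤ L * (u - t) :=
      (abs_norm_sub_norm_le _ _).trans ((norm_m_le (z u - z t)).trans (hLip t hat u hu))
    have h2 : |‖(z u).2.1‖ + ‖(z t).2.1‖| ≤ 2 * R := by
      rw [abs_of_nonneg (by positivity)]
      linarith [(norm_m_le (z u)).trans (hR u (hat.le.trans hu)),
        (norm_m_le (z t)).trans (hR t hat.le)]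
    rw [sq_sub_sq, abs_mul, mul_assoc]
    exact mul_le_mul h2 h1 (abs_nonneg _) (by positivity)

theorem IsSolution.slowlyVarying_x (D : Setting F S ε)
    (hc : CoeffAssumption h r p q hInf rInf pInf qInf) (ha : 0 < a) {z₀ : Z d}
    (hz : IsSolution F S h r p q ε a z₀ z) : SlowlyVarying fun t => (z t).2.2 := by
  intro L hL δ hδ
  have hε := Real.sqrt_pos.2 D.ε_pos
  obtain ⟨T, hT⟩ := Metric.tendsto_atTop.1 (hz.tendsto_m D hc ha) (δ / L * √ε) (by positivity)
  filter_upwards [eventually_gt_atTop (max T a)] with t ht u hu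
  have hat : a < t := (le_max_right _ _).trans_lt ht
  have hTt : T < t := (le_max_left _ _).trans_lt ht
  have h1 := norm_sub_le_of_hasDerivAt (y := fun t => (z t).2.2) (C := δ / L)
    (hz.cont.snd.snd.mono fun s hs => hat.le.trans hs.1)
    (fun s hs => hasDerivAt_x (hz.hasDerivAt ha (hat.trans hs.1))) (fun s hs => by
      refine (norm_velocity_le D.ε_pos (hz.mem s (hat.trans hs.1).le) _).trans ?_
      rw [div_le_iff₀ hε]
      have := hT s (hTt.trans hs.1).le
      rw [dist_zero_right] at this
      exact this.le) hu.1
  refine h1.trans ?_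
  have h2 : u - t ≤ L := by linarith [hu.2]
  calc δ / L * (u - t) ≤ δ / L * L := by gcongr
    _ = δ := by field_simp

theorem IsSolution.convergesToSet (D : Setting F S ε)
    (hc : CoeffAssumption h r p q hInf rInf pInf qInf) (ha : 0 < a) {z₀ : Z d}
    (hz : IsSolution F S h r p q ε a z₀ z) : ConvergesToSet z (limitSet F S pInf qInf) := by
  obtain ⟨x₁, hx₁⟩ := D.exists_critical
  refine ⟨⟨_, x₁, hx₁, rfl⟩, ?_⟩
  obtain ⟨R, hR⟩ := hz.isBounded D hc ha
  have hm := hz.tendsto_m D hc ha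
  have hx := hz.slowlyVarying_x D hc ha
  have hxR : ∀ t > a, ‖(z t).2.2‖ ≤ R := fun t ht => (norm_x_le _).trans (hR t ht.le)
  have hmG := tendsto_sub_smul_of_slowlyVarying hx D.grad_lip.continuous hxR
    (hc.h_lim.div hc.r_lim hc.rInf_pos.ne') hc.rInf_pos
    (fun t ht => hc.rInf_le (ha.trans ht)) (fun t ht => (norm_m_le _).trans (hR t ht.le))
    (fun t ht => hasDerivAt_m (hc.r_pos (ha.trans ht)).ne' (hz.hasDerivAt ha ht))
  have hvS := tendsto_sub_smul_of_slowlyVarying hx D.S_lip.continuous hxR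
    (hc.p_lim.div hc.q_lim hc.qInf_pos.ne') hc.qInf_pos
    (fun t ht => hc.qInf_le (ha.trans ht)) (fun t ht => (norm_fst_le _).trans (hR t ht.le))
    (fun t ht => hasDerivAt_v (hc.q_pos (ha.trans ht)).ne' (hz.hasDerivAt ha ht))
  have hG : Tendsto (fun t => (hInf / rInf) • gradient F (z t).2.2) atTop (𝓝 0) := by
    simpa using hm.sub hmG
  -- The orbit is bounded, so along any sequence of times some subsequence of `x` converges; its
  -- limit is critical, and `v`, `m` follow.
  refine tendsto_of_subseq_tendsto fun ns hns => ?_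
  obtain ⟨xs, -, φ, hφ, hxs⟩ := tendsto_subseq_of_frequently_bounded
    (Metric.isBounded_closedBall (x := (0 : E d)) (r := R)) (x := fun n => (z (ns n)).2.2)
    ((hns.eventually (eventually_gt_atTop a)).mono fun n hn => by
      simpa using hxR _ hn).frequently
  have hsub : Tendsto (fun n => ns (φ n)) atTop atTop := hns.comp hφ.tendsto_atTop
  have hxs' : Tendsto (fun n => (z (ns (φ n))).2.2) atTop (𝓝 xs) := hxs
  have hcrit : gradient F xs = 0 := by
    have h1 := ((D.grad_lip.continuous.tendsto xs).comp hxs').const_smul (hInf / rInf)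
    have h2 := tendsto_nhds_unique h1 (hG.comp hsub)
    exact (smul_eq_zero.1 h2).resolve_left (div_pos hc.hInf_pos hc.rInf_pos).ne'
  have hv' : Tendsto (fun n => (z (ns (φ n))).1) atTop (𝓝 ((pInf / qInf) • S xs)) := by
    have h1 := ((D.S_lip.continuous.tendsto xs).comp hxs').const_smul (pInf / qInf)
    have h2 := (hvS.comp hsub).add h1
    simpa using h2
  have hz' : Tendsto (fun n => z (ns (φ n))) atTop (𝓝 ((pInf / qInf) • S xs, 0, xs)) :=
    hv'.prodMk_nhds ((hm.comp hsub).prodMk_nhds hxs')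
  refine ⟨φ, ?_⟩
  have h1 := ((Metric.continuous_infDist_pt (limitSet F S pInf qInf)).tendsto _).comp hz'
  rwa [Metric.infDist_zero_of_mem (show ((pInf / qInf) • S xs, (0 : E d), xs) ∈
    limitSet F S pInf qInf from ⟨xs, hcrit, rfl⟩)] at h1

theorem uniqueBoundedConvergent_of_pos (D : Setting F S ε)
    (hc : CoeffAssumption h r p q hInf rInf pInf qInf) (ha : 0 < a) {z₀ : Z d}
    (hz₀ : z₀ ∈ ZPlus d) : UniqueBoundedConvergent F S h r p q ε pInf qInf a z₀ := by
  obtain ⟨z, hz⟩ := exists_isSolution D hc ha hz₀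
  obtain ⟨R, hR⟩ := hz.isBounded D hc ha
  refine ⟨z, hz, fun y hy => hy.eqOn D hc ha hz ha.le ha.le le_rfl le_rfl
    (hy.init.trans hz.init.symm), ?_, hz.convergesToSet D hc ha⟩
  refine (Metric.isBounded_closedBall (x := (0 : Z d)) (r := R)).subset ?_
  rintro _ ⟨t, ht, rfl⟩
  simpa using hR t ht

end AdamODE

namespace AdamODE

variable {d : ℕ} {F : E d → ℝ} {S : E d → E d} {h r p q : ℝ → ℝ}
  {ε hInf rInf pInf qInf a b : ℝ} {z : ℝ → Z d}

/-! ### Starting at time zero -/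

theorem IsSolution.restart {z₀ : Z d} (hz : IsSolution F S h r p q ε a z₀ z) {a' : ℝ}
    (ha : a ≤ a') : IsSolution F S h r p q ε a' (z a') z where
  init := rfl
  cont := hz.cont.mono (Ici_subset_Ici.2 ha)
  mem t ht := hz.mem t (le_trans ha ht)
  eqn t ht h0 := (hz.eqn t (le_trans ha ht) h0).mono (Ici_subset_Ici.2 ha)

/-- Solutions that start from `z₀` at small positive times stay close to `z₀` for a while. -/
def ModulusAtZero (F : E d → ℝ) (S : E d → E d) (h r p q : ℝ → ℝ) (ε : ℝ) (z₀ : Z d) : Prop :=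
  ∀ η > 0, ∃ σ > 0, ∀ s b z, 0 < s → b ≤ σ → SolOn F S h r p q ε s b z → z s = z₀ →
    ∀ t ∈ Icc s b, ‖z t - z₀‖ ≤ η

/-- Bounded solutions on small intervals `[s, b]`, `0 < s`, depend on their value at `s` in a
Lipschitz way, uniformly in `s`. -/
def StableAtZero (F : E d → ℝ) (S : E d → E d) (h r p q : ℝ → ℝ) (ε : ℝ) : Prop :=
  ∀ R, ∃ τ > 0, ∃ C ≥ 0, ∀ s b y z, 0 < s → b ≤ τ → SolOn F S h r p q ε s b y →
    SolOn F S h r p q ε s b z → (∀ t ∈ Icc s b, ‖y t‖ ≤ R) → (∀ t ∈ Icc s b, ‖z t‖ ≤ R) →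
    ∀ t ∈ Icc s b, ‖y t - z t‖ ≤ C * ‖y s - z s‖

/-- Two solutions of relaxation equations with the same rate and Lipschitz targets. -/
theorem relaxation_sub_norm_le {V : Type*} [NormedAddCommGroup V] [InnerProductSpace ℝ V]
    {y y' w w' : ℝ → V} {ρ : ℝ → ℝ} {R : ℝ}
    (hy : ContinuousOn y (Icc a b)) (hy' : ContinuousOn y' (Icc a b))
    (hd : ∀ t ∈ Ioo a b, HasDerivAt y (ρ t • (w t - y t)) t)
    (hd' : ∀ t ∈ Ioo a b, HasDerivAt y' (ρ t • (w' t - y' t)) t)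
    (hρ : ∀ t ∈ Ioo a b, 0 ≤ ρ t) (hw : ∀ t ∈ Ioo a b, ‖w t - w' t‖ ≤ R)
    (h0 : ‖y a - y' a‖ ≤ R) : ∀ t ∈ Icc a b, ‖y t - y' t‖ ≤ R := by
  have := relaxation_norm_le (y := fun t => y t - y' t) (w := fun t => w t - w' t) (ρ := ρ)
    (c := 0) (R := R) (hy.sub hy') (fun t ht => by
      have h1 := (hd t ht).sub (hd' t ht)
      rw [← smul_sub, sub_sub_sub_comm] at h1
      exact h1) hρ (by simpa using hw) (by simpa using h0)
  simpa using this

/-- The differences of `v` and `m` are controlled by the initial gap `N` and the largest gap `X` in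
`x`, whatever the rates. The velocity is then Lipschitz in `N + X`, so on a short interval `X ≤ N +
(N + X)/2`, that is `X ≤ 3N`. -/
theorem stableAtZero (D : Setting F S ε) (hc : CoeffAssumption h r p q hInf rInf pInf qInf)
    {M : ℝ} (hM0 : 0 ≤ M) (hM : ∀ᶠ t in 𝓝[>] (0 : ℝ), |h t / r t| ≤ M ∧ |p t / q t| ≤ M) :
    StableAtZero F S h r p q ε := by
  intro R
  obtain ⟨KS, hKS0, hKS⟩ := exists_lipschitzOn_ball D.S_lip R
  obtain ⟨KG, hKG0, hKG⟩ := exists_lipschitzOn_ball D.grad_lip R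
  obtain ⟨τ₁, hτ₁, hMτ⟩ := mem_nhdsGT_iff_exists_Ioo_subset.1 hM
  have hε := D.ε_pos
  set α := (√ε)⁻¹
  set β := |R| / (ε * √ε)
  have hα : 0 ≤ α := by positivity
  have hβ : 0 ≤ β := by positivity
  set Q := α + β + M * (α * KG + β * KS) with hQ
  have hQ0 : 0 ≤ Q := by positivity
  -- The length makes `Q` times the elapsed time at most `1/2`; the constant results from inserting
  -- `X ≤ 3N` in the three components.
  refine ⟨min τ₁ (1 / (2 * (Q + 1))), lt_min hτ₁ (by positivity), 3 + 3 * M * KG + 3 * M * KS,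
    by positivity, ?_⟩
  intro s b y z hs hb hy hz hyR hzR t ht
  have hsb : s ≤ b := ht.1.trans ht.2
  have hpos : ∀ u ∈ Ioo s b, 0 < u := fun u hu => hs.trans hu.1
  have hMu : ∀ u ∈ Ioo s b, |h u / r u| ≤ M ∧ |p u / q u| ≤ M := fun u hu =>
    hMτ ⟨hpos u hu, hu.2.trans_le (hb.trans (min_le_left _ _))⟩
  set N := ‖y s - z s‖ with hN
  have hN0 : 0 ≤ N := norm_nonneg _
  obtain ⟨u₀, hu₀, hmax⟩ := isCompact_Icc.exists_isMaxOn (nonempty_Icc.2 hsb)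
    ((hy.cont.snd.snd.sub hz.cont.snd.snd).norm)
  set X := ‖(y u₀).2.2 - (z u₀).2.2‖ with hX
  have hX0 : 0 ≤ X := norm_nonneg _
  have hxX : ∀ u ∈ Icc s b, ‖(y u).2.2 - (z u).2.2‖ ≤ X := fun u hu => hmax hu
  have target : ∀ (Φ : E d → E d) (K : ℝ), 0 ≤ K →
      (∀ x y, ‖x‖ ≤ R → ‖y‖ ≤ R → ‖Φ x - Φ y‖ ≤ K * ‖x - y‖) → ∀ A, |A| ≤ M →
      ∀ u ∈ Ioo s b, ‖A • Φ (y u).2.2 - A • Φ (z u).2.2‖ ≤ N + M * K * X := by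
    intro Φ K hK0 hK A hA u hu
    have huI := Ioo_subset_Icc_self hu
    rw [← smul_sub, norm_smul, Real.norm_eq_abs]
    have h1 := hK _ _ ((norm_x_le _).trans (hyR u huI)) ((norm_x_le _).trans (hzR u huI))
    calc |A| * ‖Φ (y u).2.2 - Φ (z u).2.2‖ ≤ M * (K * X) :=
          mul_le_mul hA (h1.trans (mul_le_mul_of_nonneg_left (hxX u huI) hK0))
            (norm_nonneg _) hM0
      _ ≤ N + M * K * X := by linarith
  have hv := relaxation_sub_norm_le (R := N + M * KS * X) hy.cont.fst hz.cont.fst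
    (fun u hu => hasDerivAt_v (hc.q_pos (hpos u hu)).ne' (hy.deriv u hu))
    (fun u hu => hasDerivAt_v (hc.q_pos (hpos u hu)).ne' (hz.deriv u hu))
    (fun u hu => hc.q_nonneg u (hpos u hu))
    (fun u hu => target S KS hKS0 hKS _ (hMu u hu).2 u hu)
    ((norm_fst_le (y s - z s)).trans (le_add_of_nonneg_right (by positivity)))
  have hm := relaxation_sub_norm_le (R := N + M * KG * X) hy.cont.snd.fst hz.cont.snd.fst
    (fun u hu => hasDerivAt_m (hc.r_pos (hpos u hu)).ne' (hy.deriv u hu))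
    (fun u hu => hasDerivAt_m (hc.r_pos (hpos u hu)).ne' (hz.deriv u hu))
    (fun u hu => hc.r_nonneg u (hpos u hu))
    (fun u hu => target (gradient F) KG hKG0 hKG _ (hMu u hu).1 u hu)
    ((norm_m_le (y s - z s)).trans (le_add_of_nonneg_right (by positivity)))
  have hvel : ∀ u ∈ Ioo s b,
      ‖velocity ε (y u).1 (y u).2.1 - velocity ε (z u).1 (z u).2.1‖ ≤ Q * (N + X) := by
    intro u hu
    have huI := Ioo_subset_Icc_self hu
    have h1 := norm_velocity_sub_le (m := (y u).2.1) hε (hy.mem u huI) (hz.mem u huI)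
      (((norm_m_le _).trans (hzR u huI)).trans (le_abs_self R))
    calc _ ≤ α * ‖(y u).2.1 - (z u).2.1‖ + β * ‖(y u).1 - (z u).1‖ := h1
      _ ≤ α * (N + M * KG * X) + β * (N + M * KS * X) := by
          gcongr
          · exact hm u huI
          · exact hv u huI
      _ ≤ Q * (N + X) := by
          have h2 : 0 ≤ M * (α * KG + β * KS) * N := by positivity
          have h3 : 0 ≤ (α + β) * X := by positivity
          rw [hQ]
          linarith
  have hXle : X ≤ 3 * N := by
    have h1 := norm_sub_le_of_hasDerivAt (y := fun u => (y u).2.2 - (z u).2.2) (s := s) (t := u₀)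
      ((hy.cont.snd.snd.sub hz.cont.snd.snd).mono (Icc_subset_Icc_right hu₀.2))
      (fun u hu => (hasDerivAt_x (hy.deriv u (Ioo_subset_Ioo_right hu₀.2 hu))).sub
        (hasDerivAt_x (hz.deriv u (Ioo_subset_Ioo_right hu₀.2 hu))))
      (fun u hu => hvel u (Ioo_subset_Ioo_right hu₀.2 hu)) hu₀.1
    have h2 : ‖(y s).2.2 - (z s).2.2‖ ≤ N := norm_x_le (y s - z s)
    have h3 := norm_le_norm_sub_add ((y u₀).2.2 - (z u₀).2.2) ((y s).2.2 - (z s).2.2)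
    have h4 : Q * (N + X) * (u₀ - s) ≤ (N + X) / 2 := by
      have h5 : u₀ - s ≤ 1 / (2 * (Q + 1)) := by
        linarith [hu₀.2, hb.trans (min_le_right τ₁ (1 / (2 * (Q + 1))))]
      have h6 : Q * (1 / (2 * (Q + 1))) ≤ 1 / 2 := by
        rw [mul_one_div, div_le_div_iff₀ (by positivity) (by norm_num)]
        linarith
      calc Q * (N + X) * (u₀ - s) ≤ Q * (N + X) * (1 / (2 * (Q + 1))) := by gcongr
        _ = (Q * (1 / (2 * (Q + 1)))) * (N + X) := by ring
        _ ≤ 1 / 2 * (N + X) := by gcongr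
        _ = (N + X) / 2 := by ring
    linarith
  have hMG : M * KG * X ≤ M * KG * (3 * N) := by gcongr
  have hMS : M * KS * X ≤ M * KS * (3 * N) := by gcongr
  have p1 : 0 ≤ M * KG * N := by positivity
  have p2 : 0 ≤ M * KS * N := by positivity
  rw [Prod.norm_def, Prod.norm_def]
  refine max_le ((hv t ht).trans ?_) (max_le ((hm t ht).trans ?_) ((hxX t ht).trans ?_)) <;>
    linarith

theorem eqOn_of_stableAtZero (D : Setting F S ε)
    (hc : CoeffAssumption h r p q hInf rInf pInf qInf) (hst : StableAtZero F S h r p q ε)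
    {z₀ : Z d} {y : ℝ → Z d} (hy : IsSolution F S h r p q ε 0 z₀ y)
    (hz : IsSolution F S h r p q ε 0 z₀ z) : EqOn y z (Ici 0) := by
  obtain ⟨R₁, h₁⟩ := (hy.solOn le_rfl le_rfl 1).exists_bound
  obtain ⟨R₂, h₂⟩ := (hz.solOn le_rfl le_rfl 1).exists_bound
  obtain ⟨τ, hτ, C, hC0, hC⟩ := hst (max R₁ R₂)
  set θ := min τ 1
  have hθ : 0 < θ := lt_min hτ one_pos
  have hnear : ∀ t ∈ Ioc 0 θ, y t = z t := by
    intro t ht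
    have hlim : Tendsto (fun s => C * ‖y s - z s‖) (𝓝[>] 0) (𝓝 0) := by
      have h3 := (((hy.cont.sub hz.cont).norm) 0 self_mem_Ici).const_mul C
      have h4 := h3.tendsto.mono_left (nhdsWithin_mono 0 Ioi_subset_Ici_self)
      simpa [hy.init, hz.init] using h4
    have h5 : ‖y t - z t‖ ≤ 0 := by
      refine ge_of_tendsto hlim ?_
      filter_upwards [Ioo_mem_nhdsGT ht.1] with s hs
      have hsub : ∀ u ∈ Icc s θ, u ∈ Icc (0 : ℝ) 1 := fun u hu =>
        ⟨hs.1.le.trans hu.1, hu.2.trans (min_le_right _ _)⟩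
      exact hC s θ y z hs.1 (min_le_left _ _) (hy.solOn le_rfl hs.1.le θ)
        (hz.solOn le_rfl hs.1.le θ) (fun u hu => le_max_of_le_left (h₁ u (hsub u hu)))
        (fun u hu => le_max_of_le_right (h₂ u (hsub u hu))) t ⟨hs.2.le, ht.2⟩
    exact sub_eq_zero.1 (norm_le_zero_iff.1 h5)
  intro t ht
  rcases eq_or_lt_of_le (show 0 ≤ t from ht) with rfl | ht0
  · rw [hy.init, hz.init]
  rcases le_total t θ with h3 | h3
  · exact hnear t ⟨ht0, h3⟩
  · exact hy.eqOn D hc hθ hz le_rfl le_rfl hθ.le hθ.le (hnear θ ⟨hθ, le_rfl⟩) h3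

theorem isClosed_ZPlus : IsClosed (ZPlus d) := by
  have : ZPlus d = ⋂ i, {z : Z d | 0 ≤ z.1 i} := by ext; simp [ZPlus]
  rw [this]
  exact isClosed_iInter fun i => isClosed_le continuous_const (by fun_prop)

/-- The solutions started from `z₀` at times `s > 0` converge as `s → 0`. -/
theorem exists_limit_at_zero (hst : StableAtZero F S h r p q ε)
    {z₀ : Z d} (hmod : ModulusAtZero F S h r p q ε z₀) {w : ℝ → ℝ → Z d}
    (hw : ∀ s > 0, IsSolution F S h r p q ε s z₀ (w s)) :
    ∃ θ > 0, ∀ u ∈ Ioc 0 θ, ∃ ζ, Tendsto (fun s => w s u) (𝓝[>] 0) (𝓝 ζ) := by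
  obtain ⟨σ₁, hσ₁, h₁⟩ := hmod 1 one_pos
  obtain ⟨τ, hτ, C, hC0, hC⟩ := hst (‖z₀‖ + 1)
  refine ⟨min σ₁ τ, lt_min hσ₁ hτ, fun u hu => ?_⟩
  have hbd : ∀ s > 0, ∀ t ∈ Icc s (min σ₁ τ), ‖w s t‖ ≤ ‖z₀‖ + 1 := fun s hs t ht => by
    have h2 := h₁ s _ (w s) hs (min_le_left _ _) ((hw s hs).solOn hs.le le_rfl _) (hw s hs).init t ht
    linarith [norm_le_norm_sub_add (w s t) z₀]
  refine cauchy_map_iff_exists_tendsto.1 (Metric.cauchy_iff.2 ⟨inferInstance, fun η hη => ?_⟩)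
  set η' := η / (2 * (C + 1)) with hη'
  obtain ⟨σ, hσ, h₂⟩ := hmod η' (by positivity)
  have hclose : ∀ s₁ s₂, 0 < s₁ → s₁ ≤ s₂ → s₂ < min u σ → dist (w s₁ u) (w s₂ u) < η := by
    intro s₁ s₂ h0 h12 h2
    have h20 := h0.trans_le h12
    have h2u : s₂ < u := h2.trans_le (min_le_left _ _)
    have h3 := hC s₂ (min σ₁ τ) (w s₁) (w s₂) h20 (min_le_right _ _)
      ((hw s₁ h0).solOn h0.le h12 _) ((hw s₂ h20).solOn h20.le le_rfl _)
      (fun t ht => hbd s₁ h0 t ⟨h12.trans ht.1, ht.2⟩) (hbd s₂ h20) u ⟨h2u.le, hu.2⟩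
    -- The later solution is at `z₀` at time `s₂`; the modulus says that the earlier one is still
    -- close to it.
    have h4 := h₂ s₁ s₂ (w s₁) h0 (h2.le.trans (min_le_right _ _))
      ((hw s₁ h0).solOn h0.le le_rfl _) (hw s₁ h0).init s₂ ⟨h12, le_rfl⟩
    rw [(hw s₂ h20).init] at h3
    rw [dist_eq_norm]
    calc ‖w s₁ u - w s₂ u‖ ≤ C * η' := h3.trans (by gcongr)
      _ ≤ (C + 1) * η' := by gcongr; linarith
      _ = η / 2 := by rw [hη']; field_simp
      _ < η := by linarith
  refine ⟨(fun s => w s u) '' Ioo 0 (min u σ),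
    image_mem_map (Ioo_mem_nhdsGT (lt_min hu.1 hσ)), ?_⟩
  rintro _ ⟨s₁, hs₁, rfl⟩ _ ⟨s₂, hs₂, rfl⟩
  rcases le_total s₁ s₂ with h12 | h12
  · exact hclose s₁ s₂ hs₁.1 h12 hs₂.2
  · rw [dist_comm]
    exact hclose s₂ s₁ hs₂.1 h12 hs₁.2

/-- The pointwise limit `ζ` of the solutions started at times `s → 0` is a solution because, by
continuous dependence from any `u > 0`, it coincides with the solution started from `ζ u`. The
modulus gives continuity at `0`. -/
theorem exists_isSolution_zero (D : Setting F S ε)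
    (hc : CoeffAssumption h r p q hInf rInf pInf qInf) (hst : StableAtZero F S h r p q ε)
    {z₀ : Z d} (hz₀ : z₀ ∈ ZPlus d) (hmod : ModulusAtZero F S h r p q ε z₀) :
    ∃ z : ℝ → Z d, IsSolution F S h r p q ε 0 z₀ z := by
  have hex : ∀ s : ℝ, ∃ w : ℝ → Z d, 0 < s → IsSolution F S h r p q ε s z₀ w := fun s => by
    by_cases hs : 0 < s
    · obtain ⟨w, hw⟩ := exists_isSolution D hc hs hz₀
      exact ⟨w, fun _ => hw⟩
    · exact ⟨0, fun h => absurd h hs⟩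
  choose w hw using hex
  obtain ⟨θ, hθ, hlim⟩ := exists_limit_at_zero hst hmod hw
  choose! ζ hζ using hlim
  have hζmem : ∀ u ∈ Ioc 0 θ, ζ u ∈ ZPlus d := fun u hu =>
    isClosed_ZPlus.mem_of_tendsto (hζ u hu) (by
      filter_upwards [Ioo_mem_nhdsGT hu.1] with s hs
      exact (hw s hs.1).mem u hs.2.le)
  have hζη : ∀ η > 0, ∃ σ > 0, ∀ u ∈ Ioc 0 θ, u ≤ σ → ‖ζ u - z₀‖ ≤ η := by
    intro η hη
    obtain ⟨σ, hσ, h₁⟩ := hmod η hη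
    refine ⟨σ, hσ, fun u hu huσ => le_of_tendsto ((hζ u hu).sub_const z₀).norm ?_⟩
    filter_upwards [Ioo_mem_nhdsGT hu.1] with s hs
    exact h₁ s u (w s) hs.1 huσ ((hw s hs.1).solOn hs.1.le le_rfl _) (hw s hs.1).init u
      ⟨hs.2.le, le_rfl⟩
  have hex' : ∀ u, ∃ Y : ℝ → Z d, u ∈ Ioc 0 θ → IsSolution F S h r p q ε u (ζ u) Y := fun u => by
    by_cases hu : u ∈ Ioc 0 θ
    · obtain ⟨Y, hY⟩ := exists_isSolution D hc hu.1 (hζmem u hu)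
      exact ⟨Y, fun _ => hY⟩
    · exact ⟨0, fun h => absurd h hu⟩
  choose Y hY using hex'
  obtain ⟨σ₁, hσ₁, h₁⟩ := hmod 1 one_pos
  have hYζ : ∀ u ∈ Ioc 0 (min θ σ₁), ∀ t ∈ Icc u (min θ σ₁), Y u t = ζ t := by
    intro u hu t ht
    have huθ : u ∈ Ioc 0 θ := ⟨hu.1, hu.2.trans (min_le_left _ _)⟩
    have hYu := (hY u huθ).solOn hu.1.le le_rfl (min θ σ₁)
    obtain ⟨R₂, h₂⟩ := hYu.exists_bound
    obtain ⟨C, hC⟩ := exists_stability D hc hu.1 (min θ σ₁) (max (‖z₀‖ + 1) R₂)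
    have hto : Tendsto (fun s => w s t - Y u t) (𝓝[>] 0) (𝓝 0) := by
      have h3 : Tendsto (fun s => ‖w s u - Y u u‖ * C) (𝓝[>] 0) (𝓝 0) := by
        rw [(hY u huθ).init]
        simpa using (((hζ u huθ).sub_const (ζ u)).norm).mul_const C
      refine squeeze_zero_norm' ?_ h3
      filter_upwards [Ioo_mem_nhdsGT hu.1] with s hs
      refine hC (w s) (Y u) ((hw s hs.1).solOn hs.1.le hs.2.le _) hYu (fun t' ht' => ?_)
        (fun t' ht' => le_max_of_le_right (h₂ t' ht')) t ht
      have h4 := h₁ s (min θ σ₁) (w s) hs.1 (min_le_right _ _)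
        ((hw s hs.1).solOn hs.1.le le_rfl _) (hw s hs.1).init t' ⟨hs.2.le.trans ht'.1, ht'.2⟩
      exact le_max_of_le_left (by linarith [norm_le_norm_sub_add (w s t') z₀])
    have h5 := (hζ t ⟨hu.1.trans_le ht.1, ht.2.trans (min_le_left _ _)⟩).sub_const (Y u t)
    exact (sub_eq_zero.1 (tendsto_nhds_unique h5 hto)).symm
  set ϑ := min θ σ₁
  have hϑ : 0 < ϑ := lt_min hθ hσ₁
  have hϑθ : ∀ u ∈ Ioc 0 ϑ, u ∈ Ioc 0 θ := fun u hu => ⟨hu.1, hu.2.trans (min_le_left _ _)⟩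
  -- For `0 < t ≤ ϑ` this is `Y t t = ζ t`; beyond `ϑ` it follows the single solution `Y ϑ`.
  set z : ℝ → Z d := fun t => if t ≤ 0 then z₀ else Y (min t ϑ) t with hzdef
  have hzζ : ∀ t ∈ Ioc 0 ϑ, z t = ζ t := by
    intro t ht
    simp only [hzdef, if_neg (not_le.2 ht.1), min_eq_left ht.2]
    exact (hY t (hϑθ t ht)).init
  have hzY : ∀ u ∈ Ioc 0 ϑ, EqOn z (Y u) (Ici u) := by
    intro u hu t ht
    have ht0 : 0 < t := hu.1.trans_le ht
    rcases le_total t ϑ with h2 | h2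
    · rw [hzζ t ⟨ht0, h2⟩, hYζ u hu t ⟨ht, h2⟩]
    · simp only [hzdef, if_neg (not_le.2 ht0), min_eq_right h2]
      have hϑI : ϑ ∈ Ioc 0 ϑ := ⟨hϑ, le_rfl⟩
      refine (hY ϑ (hϑθ ϑ hϑI)).eqOn D hc hϑ (hY u (hϑθ u hu)) hϑ.le hu.1.le le_rfl hu.2 ?_ h2
      rw [(hY ϑ (hϑθ ϑ hϑI)).init, hYζ u hu ϑ ⟨hu.2, le_rfl⟩]
  have hz0 : z 0 = z₀ := by simp [hzdef]
  have hlocal : ∀ t > 0, ∃ u ∈ Ioc 0 ϑ, u < t := fun t ht =>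
    ⟨min (t / 2) ϑ, ⟨lt_min (by positivity) hϑ, min_le_right _ _⟩,
      (min_le_left _ _).trans_lt (by linarith)⟩
  have hder : ∀ t > 0, HasDerivAt z (field F S h r p q ε (z t) t) t := by
    intro t ht
    obtain ⟨u, hu, hut⟩ := hlocal t ht
    rw [hzY u hu hut.le]
    refine ((hY u (hϑθ u hu)).hasDerivAt hu.1 hut).congr_of_eventuallyEq ?_
    exact (hzY u hu).eventuallyEq_of_mem (Ici_mem_nhds hut)
  refine ⟨z, hz0, fun t ht => ?_, fun t ht => ?_, fun t _ ht0 => (hder t ht0).hasDerivWithinAt⟩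
  · rcases eq_or_lt_of_le (show 0 ≤ t from ht) with rfl | ht0
    · rw [ContinuousWithinAt, hz0, Metric.tendsto_nhds]
      intro η hη
      obtain ⟨σ, hσ, h₂⟩ := hζη (η / 2) (by positivity)
      filter_upwards [self_mem_nhdsWithin,
        mem_nhdsWithin_of_mem_nhds (Iio_mem_nhds (lt_min hσ hϑ))] with s hs0 hs
      rcases eq_or_lt_of_le (show 0 ≤ s from hs0) with rfl | hs0'
      · rw [hz0, dist_self]
        exact hη
      · have hsI : s ∈ Ioc 0 ϑ := ⟨hs0', (lt_min_iff.1 hs).2.le⟩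
        rw [hzζ s hsI, dist_eq_norm]
        linarith [h₂ s (hϑθ s hsI) (lt_min_iff.1 hs).1.le]
    · exact (hder t ht0).continuousAt.continuousWithinAt
  · rcases eq_or_lt_of_le (show 0 ≤ t from ht) with rfl | ht0
    · rwa [hz0]
    · obtain ⟨u, hu, hut⟩ := hlocal t ht0
      rw [hzY u hu hut.le]
      exact (hY u (hϑθ u hu)).mem t hut.le

theorem uniqueBoundedConvergent_zero (D : Setting F S ε)
    (hc : CoeffAssumption h r p q hInf rInf pInf qInf) (hst : StableAtZero F S h r p q ε)
    {z₀ : Z d} (hz₀ : z₀ ∈ ZPlus d) (hmod : ModulusAtZero F S h r p q ε z₀) :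
    UniqueBoundedConvergent F S h r p q ε pInf qInf 0 z₀ := by
  obtain ⟨z, hz⟩ := exists_isSolution_zero D hc hst hz₀ hmod
  have hz1 := hz.restart zero_le_one
  obtain ⟨R₁, h₁⟩ := (hz.solOn le_rfl le_rfl 1).exists_bound
  obtain ⟨R₂, h₂⟩ := hz1.isBounded D hc one_pos
  refine ⟨z, hz, fun y hy => eqOn_of_stableAtZero D hc hst hy hz, ?_,
    hz1.convergesToSet D hc one_pos⟩
  refine (Metric.isBounded_closedBall (x := (0 : Z d)) (r := max R₁ R₂)).subset ?_
  rintro _ ⟨t, ht, rfl⟩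
  rw [mem_closedBall_zero_iff]
  rcases le_total t 1 with h3 | h3
  · exact le_max_of_le_left (h₁ t ⟨ht, h3⟩)
  · exact le_max_of_le_right (h₂ t h3)

/-! ### The two alternatives at time zero -/

/-- Bounded coefficients bound the field by some `L` near `z₀`, so leaving the ball of radius `η`
takes a time independent of the start. -/
theorem modulusAtZero_of_coeffBound (D : Setting F S ε) {M : ℝ} (hM0 : 0 ≤ M)
    (hM : ∀ᶠ t in 𝓝[>] (0 : ℝ), CoeffBound h r p q M t) (z₀ : Z d) :
    ModulusAtZero F S h r p q ε z₀ := by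
  intro η hη
  obtain ⟨τ, hτ, hMτ⟩ := mem_nhdsGT_iff_exists_Ioo_subset.1 hM
  obtain ⟨L, hL⟩ := exists_field_bound (h := h) (r := r) (p := p) (q := q) D (‖z₀‖ + η) hM0
  refine ⟨min τ (η / (2 * (L + 1))), lt_min hτ (by positivity), ?_⟩
  intro s b z hs hb hz hzs t ht
  have key := le_of_forall_Ico_le_imp_le (f := fun t => ‖z t - z₀‖) (R := η) (R' := η / 2)
    ((hz.cont.sub continuousOn_const).norm) (by linarith) (fun t ht hle => ?_) t ht
  · linarith
  have htb : t ≤ η / (2 * (L + 1)) := ht.2.trans (hb.trans (min_le_right _ _))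
  have hz' := hz.mono le_rfl ht.2
  have h1 := norm_sub_le_of_hasDerivAt hz'.cont hz'.deriv (C := L) (fun u hu => by
    refine hL u (hMτ ⟨hs.trans hu.1, ?_⟩) _ (hz'.mem u (Ioo_subset_Icc_self hu)) ?_
    · exact hu.2.trans_le (ht.2.trans (hb.trans (min_le_left _ _)))
    · linarith [hle u ⟨hu.1.le, hu.2⟩, norm_le_norm_sub_add (z u) z₀]) ht.1
  rw [hzs] at h1
  refine h1.trans ?_
  calc (L : ℝ) * (t - s) ≤ (L + 1) * (η / (2 * (L + 1))) := by
        apply mul_le_mul (by linarith) (by linarith) (by linarith [ht.1]) (by positivity)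
    _ = η / 2 := by field_simp

theorem exists_smul_near {Φ : E d → E d} (hΦ : Continuous Φ) (c : ℝ) (x₀ : E d) {η : ℝ}
    (hη : 0 < η) : ∃ δ > 0, ∀ A x, |A - c| < δ → ‖x - x₀‖ < δ → ‖A • Φ x - c • Φ x₀‖ ≤ η := by
  have h1 : Continuous fun w : ℝ × E d => w.1 • Φ w.2 := by fun_prop
  obtain ⟨δ, hδ, h2⟩ := Metric.continuous_iff.1 h1 (c, x₀) η hη
  refine ⟨δ, hδ, fun A x hA hx => ?_⟩
  have h3 := h2 (A, x) (by
    rw [Prod.dist_eq]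
    exact max_lt (by rwa [Real.dist_eq]) (by rwa [dist_eq_norm]))
  rw [dist_eq_norm] at h3
  exact h3.le

/-- The compatibility conditions put `m₀` and `v₀` at the limits of their targets. While `x` stays
near `x₀` the targets stay near them, and relaxation holds `m` and `v` there at any rate; `m` being
bounded, `x` moves slowly. -/
theorem modulusAtZero_of_tendsto (D : Setting F S ε)
    (hc : CoeffAssumption h r p q hInf rInf pInf qInf) {z₀ : Z d} {α β : ℝ}
    (hα : Tendsto (fun t => h t / r t) (𝓝[>] 0) (𝓝 α)) (hm₀ : z₀.2.1 = α • gradient F z₀.2.2)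
    (hβ : Tendsto (fun t => p t / q t) (𝓝[>] 0) (𝓝 β)) (hv₀ : z₀.1 = β • S z₀.2.2) :
    ModulusAtZero F S h r p q ε z₀ := by
  intro η hη
  obtain ⟨δ₁, hδ₁, h₁⟩ := exists_smul_near D.grad_lip.continuous α z₀.2.2 hη
  obtain ⟨δ₂, hδ₂, h₂⟩ := exists_smul_near D.S_lip.continuous β z₀.2.2 hη
  have hε := Real.sqrt_pos.2 D.ε_pos
  set δ := min η (min δ₁ δ₂) / 2 with hδdef
  have hmin : 0 < min η (min δ₁ δ₂) := lt_min hη (lt_min hδ₁ hδ₂)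
  have hδ : 0 < δ := by positivity
  have hδη : δ < η := by linarith [min_le_left η (min δ₁ δ₂)]
  have hδ1 : δ < δ₁ := by linarith [(min_le_right η (min δ₁ δ₂)).trans (min_le_left δ₁ δ₂)]
  have hδ2 : δ < δ₂ := by linarith [(min_le_right η (min δ₁ δ₂)).trans (min_le_right δ₁ δ₂)]
  have hev : ∀ᶠ t in 𝓝[>] (0 : ℝ), |h t / r t - α| < δ₁ ∧ |p t / q t - β| < δ₂ :=
    ((Metric.tendsto_nhds.1 hα) δ₁ hδ₁).and ((Metric.tendsto_nhds.1 hβ) δ₂ hδ₂)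
  obtain ⟨τ, hτ, hMτ⟩ := mem_nhdsGT_iff_exists_Ioo_subset.1 hev
  set V := (‖z₀.2.1‖ + η) / √ε with hV
  have hV0 : 0 ≤ V := by positivity
  refine ⟨min τ (δ / (2 * (V + 1))), lt_min hτ (by positivity), ?_⟩
  intro s b z hs hb hz hzs
  have hmv : ∀ t ∈ Icc s b, (∀ u ∈ Ico s t, ‖(z u).2.2 - z₀.2.2‖ ≤ δ) →
      ∀ u ∈ Icc s t, ‖(z u).2.1 - z₀.2.1‖ ≤ η ∧ ‖(z u).1 - z₀.1‖ ≤ η := by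
    intro t ht hle u hu
    have hz' := hz.mono le_rfl ht.2
    have hτu : ∀ u ∈ Ioo s t, u ∈ Ioo 0 τ := fun u hu =>
      ⟨hs.trans hu.1, hu.2.trans_le (ht.2.trans (hb.trans (min_le_left _ _)))⟩
    have hxu : ∀ u ∈ Ioo s t, ‖(z u).2.2 - z₀.2.2‖ ≤ δ := fun u hu => hle u ⟨hu.1.le, hu.2⟩
    constructor
    · refine relaxation_norm_le hz'.cont.snd.fst
        (fun u hu => hasDerivAt_m (hc.r_pos (hτu u hu).1).ne' (hz'.deriv u hu))
        (fun u hu => hc.r_nonneg u (hτu u hu).1) (fun u hu => ?_) ?_ u hu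
      · rw [hm₀]
        exact h₁ _ _ (hMτ (hτu u hu)).1 ((hxu u hu).trans_lt hδ1)
      · simp [hzs, hη.le]
    · refine relaxation_norm_le hz'.cont.fst
        (fun u hu => hasDerivAt_v (hc.q_pos (hτu u hu).1).ne' (hz'.deriv u hu))
        (fun u hu => hc.q_nonneg u (hτu u hu).1) (fun u hu => ?_) ?_ u hu
      · rw [hv₀]
        exact h₂ _ _ (hMτ (hτu u hu)).2 ((hxu u hu).trans_lt hδ2)
      · simp [hzs, hη.le]
  have hx := le_of_forall_Ico_le_imp_le (f := fun t => ‖(z t).2.2 - z₀.2.2‖) (R := δ)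
    (R' := δ / 2) ((hz.cont.snd.snd.sub continuousOn_const).norm) (by linarith)
    (fun t ht hle => by
      have hz' := hz.mono le_rfl ht.2
      have h3 := norm_sub_le_of_hasDerivAt (C := V) hz'.cont.snd.snd
        (fun u hu => hasDerivAt_x (hz'.deriv u hu)) (fun u hu => by
          have huI := Ioo_subset_Icc_self hu
          refine (norm_velocity_le D.ε_pos (hz'.mem u huI) _).trans ?_
          rw [hV]
          gcongr
          linarith [(hmv t ht hle u huI).1, norm_le_norm_sub_add (z u).2.1 z₀.2.1]) ht.1
      rw [hzs] at h3
      refine h3.trans ?_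
      have htb : t ≤ δ / (2 * (V + 1)) := ht.2.trans (hb.trans (min_le_right _ _))
      calc V * (t - s) ≤ (V + 1) * (δ / (2 * (V + 1))) := by
            apply mul_le_mul (by linarith) (by linarith) (by linarith [ht.1]) (by positivity)
        _ = δ / 2 := by field_simp)
  intro t ht
  have h4 := hmv t ht (fun u hu => by
    have := hx u ⟨hu.1, hu.2.le.trans ht.2⟩
    linarith) t ⟨ht.1, le_rfl⟩
  rw [Prod.norm_def, Prod.norm_def]
  exact max_le h4.2 (max_le h4.1 ((hx t ht).trans (by linarith)))

theorem ExtendsC1.eventually_abs_le {f : ℝ → ℝ} (hf : ExtendsC1 f (Ici 0)) :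
    ∃ M, ∀ᶠ t in 𝓝[>] (0 : ℝ), |f t| ≤ M := by
  obtain ⟨g, hg, hgf⟩ := hf
  have h1 : Tendsto g (𝓝[>] 0) (𝓝 (g 0)) :=
    (hg.continuousOn 0 self_mem_Ici).tendsto.mono_left (nhdsWithin_mono 0 Ioi_subset_Ici_self)
  refine ⟨|g 0| + 1, ?_⟩
  filter_upwards [h1.abs.eventually (gt_mem_nhds (lt_add_one |g 0|)), self_mem_nhdsWithin]
    with t ht ht0
  rw [← hgf t (Ioi_subset_Ici_self ht0) ht0]
  exact ht.le

theorem uniqueBoundedConvergent_of_extendsC1 (D : Setting F S ε)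
    (hc : CoeffAssumption h r p q hInf rInf pInf qInf) {z₀ : Z d} (hz₀ : z₀ ∈ ZPlus d)
    (hh : ExtendsC1 h (Ici 0)) (hr : ExtendsC1 r (Ici 0)) (hp : ExtendsC1 p (Ici 0))
    (hq : ExtendsC1 q (Ici 0)) : UniqueBoundedConvergent F S h r p q ε pInf qInf 0 z₀ := by
  obtain ⟨Mh, hMh⟩ := hh.eventually_abs_le
  obtain ⟨Mr, hMr⟩ := hr.eventually_abs_le
  obtain ⟨Mp, hMp⟩ := hp.eventually_abs_le
  obtain ⟨Mq, hMq⟩ := hq.eventually_abs_le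
  set M := |Mh| + |Mr| + |Mp| + |Mq| with hMdef
  have hM0 : 0 ≤ M := by positivity
  have hM : ∀ᶠ t in 𝓝[>] (0 : ℝ), CoeffBound h r p q M t := by
    filter_upwards [hMh, hMr, hMp, hMq] with t h1 h2 h3 h4
    have e1 := le_abs_self Mh
    have e2 := le_abs_self Mr
    have e3 := le_abs_self Mp
    have e4 := le_abs_self Mq
    have f1 := abs_nonneg Mh
    have f2 := abs_nonneg Mr
    have f3 := abs_nonneg Mp
    have f4 := abs_nonneg Mq
    exact ⟨by linarith, by linarith, by linarith, by linarith⟩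
  refine uniqueBoundedConvergent_zero D hc (stableAtZero D hc (M := M / rInf + M / qInf) ?_ ?_) hz₀
    (modulusAtZero_of_coeffBound D hM0 hM z₀)
  · have := hc.rInf_pos
    have := hc.qInf_pos
    positivity
  · have p1 : 0 ≤ M / rInf := div_nonneg hM0 hc.rInf_pos.le
    have p2 : 0 ≤ M / qInf := div_nonneg hM0 hc.qInf_pos.le
    filter_upwards [hM, self_mem_nhdsWithin] with t ht ht0
    constructor
    · rw [abs_div, abs_of_pos (hc.r_pos ht0)]
      linarith [div_le_div₀ hM0 ht.1 hc.rInf_pos (hc.rInf_le ht0)]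
    · rw [abs_div, abs_of_pos (hc.q_pos ht0)]
      linarith [div_le_div₀ hM0 ht.2.2.1 hc.qInf_pos (hc.qInf_le ht0)]

theorem uniqueBoundedConvergent_of_singularAtZero (D : Setting F S ε)
    (hc : CoeffAssumption h r p q hInf rInf pInf qInf) {z₀ : Z d} (hz₀ : z₀ ∈ ZPlus d)
    (hs : SingularAtZero F S h r p q z₀) :
    UniqueBoundedConvergent F S h r p q ε pInf qInf 0 z₀ := by
  obtain ⟨α, hα, hm₀⟩ := hs.m_init
  obtain ⟨β, hβ, hv₀⟩ := hs.v_init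
  refine uniqueBoundedConvergent_zero D hc
    (stableAtZero D hc (M := |α| + |β| + 1) (by positivity) ?_) hz₀
    (modulusAtZero_of_tendsto D hc hα hm₀ hβ hv₀)
  filter_upwards [hα.abs.eventually (gt_mem_nhds (lt_add_one |α|)),
    hβ.abs.eventually (gt_mem_nhds (lt_add_one |β|))] with t h1 h2
  exact ⟨by linarith [abs_nonneg β], by linarith [abs_nonneg α]⟩

end AdamODE

theorem mainTheorem9 {d : ℕ} (F : AdamODE.E d → ℝ) (S : AdamODE.E d → AdamODE.E d)
    (h r p q : ℝ → ℝ) (ε hInf rInf pInf qInf : ℝ) (hε : 0 < ε)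
    (hF : ContDiff ℝ 1 F) (hF_lip : LocallyLipschitz (gradient F))
    (hF_coercive : Tendsto F (Bornology.cobounded (AdamODE.E d)) atTop)
    (hS_nonneg : ∀ x i, 0 ≤ S x i) (hS_lip : LocallyLipschitz S)
    (hcoeff : AdamODE.CoeffAssumption h r p q hInf rInf pInf qInf) :
    (∀ t₀ : ℝ, 0 < t₀ → ∀ z₀ ∈ AdamODE.ZPlus d,
      AdamODE.UniqueBoundedConvergent F S h r p q ε pInf qInf t₀ z₀) ∧
    (∀ z₀ ∈ AdamODE.ZPlus d, AdamODE.ZeroTimeAssumption F S h r p q z₀ →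
      AdamODE.UniqueBoundedConvergent F S h r p q ε pInf qInf 0 z₀) := by
  have D : AdamODE.Setting F S ε := ⟨hε, hF, hF_lip, hF_coercive, hS_nonneg, hS_lip⟩
  refine ⟨fun t₀ ht₀ z₀ hz₀ => AdamODE.uniqueBoundedConvergent_of_pos D hcoeff ht₀ hz₀,
    fun z₀ hz₀ hzero => ?_⟩
  rcases hzero with ⟨hh, hr, hp, hq⟩ | hs
  · exact AdamODE.uniqueBoundedConvergent_of_extendsC1 D hcoeff hz₀ hh hr hp hq
  · exact AdamODE.uniqueBoundedConvergent_of_singularAtZero D hcoeff hz₀ hs
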